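/- **Environment.** Time is $t=1,2,\dots$; outcomes are $Y=\{0,1\}$ and actions $A=\{1,2\}$ ($1$ = safe, $2$ = innovation). The safe action has the known distribution $q^1$ with $q^1(1)=p$. The roadmap for innovation is $Q_2=\{q_L,q_H\}$ with $q_L(1)=\theta_L$, $q_H(1)=\theta_H$, $0<\theta_L<p<\theta_H<1$, and prior $\mu_1(q_H)=m\in(0,1)$. Effort costs are $c(1)=0$, $c(2)=k>0$; the agent's discount rate is $\delta\in(0,1)$, and $\gamma>0$. For $q\in Q_2$ write $q_1:=q^1$ and $q_2:=q$ for its distributions under the two actions. The true model is $(p^*_1,p^*_2)\in\Delta(Y)^A$: in each period, given the past and the current action $a_t=a$, the outcome $y_t$ has law $p^*_a$; $a_t$ is chosen before $y_t$ is realized. **Agent's state.** At a private history $h_t=(a_1,y_1,\dots,a_{t-1},y_{t-1})$ the agent holds the Bayesian posterior $\mu_t(q\mid h_t)\propto\mu_1(q)\prod_{\tau<t}q_{a_\tau}(y_\tau)$ and the misspecification concern $$\lambda_t(h_t)=\frac{\mathrm{LLR}(h_t)}{\gamma t},\qquad \mathrm{LLR}(h_t)=-\log\frac{\max_{q\in Q_2}\prod_{\tau<t}q_{a_\tau}(y_\tau)}{\max_{r\in\Delta(Y)^{A}}\prod_{\tau<t}r_{a_\tau}(y_\tau)}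 .$$ **Contracts and equilibrium.** A contract pays utility $x_t(s_t,y_t)$, where $s_t=(y_1,\dots,y_{t-1})$ is the public history; it is bounded if $\sup_{t,s,y}|x_t(s,y)|<\infty$. Let $g_q(z;\lambda)=-\frac1\lambda\log\sum_y q(y)e^{-\lambda z(y)}$ for $\lambda>0$, $g_q(z;0)=\sum_y q(y)z(y)$, and $\mathcal G_a(z;\mu,\lambda)=\sum_{q\in Q_2}\mu(q)\,g_{q_a}(z;\lambda)$. The agent's continuation values are the bounded solution of $$W_t(h_t)=\max_{a\in\{1,2\}}\Big\{\mathcal G_a\big(y\mapsto x_t(s_t,y)+\delta W_{t+1}(h_t,a,y);\,\mu_t(h_t),\lambda_t(h_t)\big)-c(a)\Big\},$$ and on an equilibrium path $a_t$ attains this maximum at the realized history $h_t$ for every $t$. **Constants.** Let $D^*_2=\min_{q\in Q_2}D_{\mathrm{KL}}(p^*_2\|q)$, $\mathcal Q_2=\arg\min_{q\in Q_2}D_{\mathrm{KL}}(p^*_2\|q)$, $\bar\lambda_k(q_H)=\frac1k\log\frac{1-p}{1-\theta_H}$, $\bar\lambda_k(q_L)=\frac1k\log\frac{p}{\theta_L}$,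 and $$\alpha^*=\frac{\gamma}{D^*_2}\max_{q\in\mathcal Q_2}\bar\lambda_k(q).$$ **Theorem 2.** Suppose $D^*_2>0$ (the roadmap is misspecified), $\mathcal Q_2$ is a singleton, and the contract is bounded. Let $\alpha_T=\frac1T\sum_{t=1}^T\mathbf 1\{a_t=2\}$. Then, almost surely, on every equilibrium path along which innovation occurs infinitely often, $$\limsup_{T\to\infty}\alpha_T\le\alpha^*,$$ and if $\alpha^*<1$, the safe action also occurs infinitely often. -/

import Mathlib

open MeasureTheory Filter

noncomputable section

namespace InnovationCycles

/-- The two arms: action 1 (safe) and action 2 (innovation). -/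
inductive Action
  | safe
  | innovate
  deriving DecidableEq

instance : Fintype Action := ⟨{.safe, .innovate}, fun a => by cases a <;> decide⟩

instance : MeasurableSpace Action := ⊤

/-- Labels of the two structured models `q_L`, `q_H` of the innovation roadmap. -/
inductive Model
  | low
  | high
  deriving DecidableEq, Inhabited

instance : Fintype Model := ⟨{.low, .high}, fun j => by cases j <;> decide⟩

/-- Outcomes: `true` is a success (`y = 1`), `false` a failure (`y = 0`). -/
abbrev Outcome := Bool

/-- The distribution on outcomes with success probability `θ`. -/
def bern (θ : ℝ) : Outcome → ℝ
  | true => θ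
  | false => 1 - θ

/-- Kullback-Leibler divergence `∑ y, p y * log (p y / q y)` (used for `q` of full support; a term
with `p y = 0` contributes `0`). -/
def klDivergence (p q : Outcome → ℝ) : ℝ :=
  ∑ y, p y * Real.log (p y / q y)

/-- Primitives of the infinite-horizon two-armed bandit contracting environment. -/
structure Env where
  /-- success probability of the known distribution `q^1` of the safe action -/
  p : ℝ
  /-- success probability of `q_L` -/
  θL : ℝ
  /-- success probability of `q_H` -/
  θH : ℝ
  /-- prior weight of `q_H` -/
  m : ℝ
  /-- cost of innovation (the safe action costs `0`) -/
  k : ℝ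
  /-- scale of the log-likelihood-ratio rule -/
  γ : ℝ
  /-- the agent's discount rate -/
  δ : ℝ
  /-- true success probability under each action -/
  pstar : Action → ℝ
  θL_pos : 0 < θL
  θL_lt_p : θL < p
  p_lt_θH : p < θH
  θH_lt_one : θH < 1
  m_pos : 0 < m
  m_lt_one : m < 1
  k_pos : 0 < k
  γ_pos : 0 < γ
  δ_pos : 0 < δ
  δ_lt_one : δ < 1
  pstar_mem : ∀ a, pstar a ∈ Set.Icc (0 : ℝ) 1

/-- A private history `(a_1, y_1, …, a_{t-1}, y_{t-1})`, in chronological order;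
the period is `t = length + 1`. -/
abbrev PrivateHistory := List (Action × Outcome)

/-- A public history `(y_1, …, y_{t-1})`, in chronological order. -/
abbrev PublicHistory := List Outcome

/-- The public projection. -/
def publicPart (h : PrivateHistory) : PublicHistory := h.map Prod.snd

/-- A contract in utility units: `x s y` is the transfer after outcome `y` at public history `s`. -/
abbrev Contract := PublicHistory → Outcome → ℝ

/-- Bounded contracts. -/
def Contract.IsBounded (x : Contract) : Prop :=
  ∃ B : ℝ, ∀ s y, |x s y| ≤ B

/-- Likelihood of a private history when action `a` has success probability `r a`. -/
def likelihood (r : Action → ℝ) (h : PrivateHistory) : ℝ :=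
  (h.map fun ay => bern (r ay.1) ay.2).prod

/-- Within-model robust valuation `g_q(x; λ) = -(1/λ) log ∑ y, q y * exp (-λ x y)`,
extended by the expectation of `x` at `λ = 0`. -/
def robustValue (q x : Outcome → ℝ) (lam : ℝ) : ℝ :=
  if lam = 0 then ∑ y, q y * x y
  else -(1 / lam) * Real.log (∑ y, q y * Real.exp (-lam * x y))

namespace Env

variable (E : Env)

/-- Success probability of a structured model under innovation. -/
def theta : Model → ℝ
  | .low => E.θL
  | .high => E.θH

/-- Success probability of a (global) structured model under each action; the safe action has the
known distribution under both models. -/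
def model (j : Model) : Action → ℝ
  | .safe => E.p
  | .innovate => E.theta j

/-- Prior over the structured models. -/
def prior : Model → ℝ
  | .low => 1 - E.m
  | .high => E.m

/-- Effort cost. -/
def cost : Action → ℝ
  | .safe => 0
  | .innovate => E.k

/-- Bayesian posterior over the structured models after a private history. -/
def posterior (h : PrivateHistory) (j : Model) : ℝ :=
  E.prior j * likelihood (E.model j) h / ∑ i, E.prior i * likelihood (E.model i) h

/-- Log-likelihood ratio of the structured models against all (action-indexed) unstructured models:
`-log (max_{q ∈ Q} likelihood / max_{r ∈ Δ(Y)^A} likelihood)`. -/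
def LLR (h : PrivateHistory) : ℝ :=
  -Real.log ((⨆ j : Model, likelihood (E.model j) h) /
    (⨆ r : Action → Set.Icc (0 : ℝ) 1, likelihood (fun a => (r a : ℝ)) h))

/-- Misspecification concern of the statistically sophisticated agent, `LLR / (γ t)`. -/
def concern (h : PrivateHistory) : ℝ :=
  E.LLR h / (E.γ * ((h.length : ℝ) + 1))

/-- One-step average robust control aggregator `𝒢_a(z; μ, λ)`. -/
def aggregator (a : Action) (z : Outcome → ℝ) (μ : Model → ℝ) (lam : ℝ) : ℝ :=
  ∑ j, μ j * robustValue (bern (E.model j a)) z lam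

/-- Value of taking action `a` at private history `h` under contract `x`, when continuation values
are given by `W`. -/
def actionValue (x : Contract) (W : PrivateHistory → ℝ) (h : PrivateHistory) (a : Action) : ℝ :=
  E.aggregator a (fun y => x (publicPart h) y + E.δ * W (h ++ [(a, y)]))
    (E.posterior h) (E.concern h) - E.cost a

/-- `W` is the agent's continuation value under contract `x`: the bounded solution of the
recursion over private histories. -/
def IsContinuationValue (x : Contract) (W : PrivateHistory → ℝ) : Prop :=
  (∃ B : ℝ, ∀ h, |W h| ≤ B) ∧
    ∀ h, W h = max (E.actionValue x W h .safe) (E.actionValue x W h .innovate)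

/-- Divergence of a structured model from the true outcome distribution of innovation. -/
def divergence (j : Model) : ℝ :=
  klDivergence (bern (E.pstar .innovate)) (bern (E.theta j))

/-- Best-fit discrepancy `D*_2 = min_{q ∈ Q_2} D_KL(p*_2 ‖ q)`. -/
def Dstar : ℝ := Finset.univ.inf' Finset.univ_nonempty E.divergence

open Classical in
/-- The set `𝒬_2 = argmin_{q ∈ Q_2} D_KL(p*_2 ‖ q)` of best-fit models. -/
def bestFit : Finset Model := {j | ∀ i, E.divergence j ≤ E.divergence i}

theorem bestFit_nonempty : E.bestFit.Nonempty := by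
  obtain ⟨j, -, hj⟩ := Finset.exists_min_image Finset.univ E.divergence Finset.univ_nonempty
  exact ⟨j, by simpa [bestFit] using hj⟩

/-- Robustness thresholds `λ̄_k(q)`. -/
def lambdaBar : Model → ℝ
  | .low => 1 / E.k * Real.log (E.p / E.θL)
  | .high => 1 / E.k * Real.log ((1 - E.p) / (1 - E.θH))

/-- The speed limit `α* = (γ / D*_2) · max_{q ∈ 𝒬_2} λ̄_k(q)`. -/
def alphaStar : ℝ :=
  E.γ / E.Dstar * E.bestFit.sup' E.bestFit_nonempty E.lambdaBar

end Env

/-- Share of innovation among the first `T` periods of an action path. -/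
def innovationShare (a : ℕ → Action) (T : ℕ) : ℝ :=
  (∑ t ∈ Finset.range T, if a t = .innovate then (1 : ℝ) else 0) / T

/-- The private history before period `t` (periods are numbered `0, 1, 2, …`) of the path with
actions `a` and outcomes `y`. -/
def pathHistory (a : ℕ → Action) (y : ℕ → Outcome) (t : ℕ) : PrivateHistory :=
  (List.range t).map fun i => (a i, y i)

/-- The random path of actions `a` and outcomes `y` is generated by the true model: the action of
period `t` is known before the outcome of period `t`, and given the past and that action, the
outcome is a success with the true probability for that action. -/
structure IsDataGenerating {Ω : Type*} {mΩ : MeasurableSpace Ω} (E : Env) (P : Measure Ω)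
    (ℱ : Filtration ℕ mΩ) (a : ℕ → Ω → Action) (y : ℕ → Ω → Outcome) : Prop where
  measurable_action : ∀ t, Measurable[ℱ t] (a t)
  measurable_outcome : ∀ t, Measurable[ℱ (t + 1)] (y t)
  outcome_law : ∀ t,
    P[fun ω => if y t ω = true then (1 : ℝ) else 0 | ℱ t] =ᵐ[P] fun ω => E.pstar (a t ω)

/-- The path is played in equilibrium under contract `x`: almost surely, at each private history
reached, the agent's action is optimal given his continuation values `W`. -/
def IsEquilibriumPath {Ω : Type*} {mΩ : MeasurableSpace Ω} (E : Env) (P : Measure Ω)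
    (x : Contract) (W : PrivateHistory → ℝ) (a : ℕ → Ω → Action) (y : ℕ → Ω → Outcome) : Prop :=
  E.IsContinuationValue x W ∧
    ∀ᵐ ω ∂P, ∀ t b,
      E.actionValue x W (pathHistory (fun i => a i ω) (fun i => y i ω) t) b ≤
        E.actionValue x W (pathHistory (fun i => a i ω) (fun i => y i ω) t) (a t ω)

end InnovationCycles

end

noncomputable section

namespace InnovationCycles

open Topology

/-! Innovation is chosen only if its robust advantage over the safe action covers the cost `k`.
Under model `q` the safe law is pointwise at most `exp (k * λ̄_k(q))` times the innovation law, so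
at concern `λ` the advantage is at most `k * λ̄_k(q) / λ`, whatever the payoffs. Once beliefs settle
on the unique best fit `q`, innovation therefore needs, asymptotically, `λ ≤ λ̄_k(q)`.
Misspecification in turn makes the log-likelihood ratio grow by at least about `D*` per trial, so
the concern is at least about `D* / γ` times the past share of innovation. Hence innovation stops
whenever that share exceeds any `c > α*`, and a count that increases only below the line `c t` stays
below it up to a constant.

Two points need work. The success rate must converge although actions depend on past outcomes;
exponential supermartingales give this in `ae_tendsto_successRate`. Also, today's action changes the
private history and with it all continuation values. Yet a bounded number of observations moves the
log-likelihood ratio only by `O(log t)`, hence the concern by `O(log t / t)`, and the posterior is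
already concentrated; with discounting, `abs_continuationValue_sub_le` makes the effect vanish.
`eventually_concern_le` combines this with the one-step bound, and `eventually_trials_le` converts
the result into a bound on trials. -/

instance : DiscreteMeasurableSpace Action := ⟨fun _ => trivial⟩

/-! ### Counting innovations along a path. -/

/-- Number of successful innovations in a private history. -/
def successes (h : PrivateHistory) : ℕ := h.count (.innovate, true)

/-- Number of failed innovations in a private history. -/
def failures (h : PrivateHistory) : ℕ := h.count (.innovate, false)

/-- Number of innovations in a private history. -/
def trials (h : PrivateHistory) : ℕ := successes h + failures h

/-- Empirical success frequency of innovation (`0` if there was none). -/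
def successRate (h : PrivateHistory) : ℝ := successes h / trials h

theorem pathHistory_succ (a : ℕ → Action) (y : ℕ → Outcome) (t : ℕ) :
    pathHistory a y (t + 1) = pathHistory a y t ++ [(a t, y t)] := by
  simp [pathHistory, List.range_succ]

theorem length_pathHistory (a : ℕ → Action) (y : ℕ → Outcome) (t : ℕ) :
    (pathHistory a y t).length = t := by
  simp [pathHistory]

theorem trials_pathHistory_succ (a : ℕ → Action) (y : ℕ → Outcome) (t : ℕ) :
    trials (pathHistory a y (t + 1)) =
      trials (pathHistory a y t) + if a t = .innovate then 1 else 0 := by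
  rw [pathHistory_succ]
  unfold trials successes failures
  rcases a t <;> rcases y t <;> simp [List.count_append] <;> ring

theorem trials_pathHistory_eq_sum (a : ℕ → Action) (y : ℕ → Outcome) (T : ℕ) :
    (trials (pathHistory a y T) : ℝ) =
      ∑ t ∈ Finset.range T, if a t = .innovate then (1 : ℝ) else 0 := by
  induction T with
  | zero => simp [pathHistory, trials, successes, failures]
  | succ T ih =>
    rw [Finset.sum_range_succ, trials_pathHistory_succ, ← ih]
    split_ifs <;> simp

theorem tendsto_trials_atTop (a : ℕ → Action) (y : ℕ → Outcome)
    (ha : ∃ᶠ t in atTop, a t = .innovate) :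
    Tendsto (fun t => trials (pathHistory a y t)) atTop atTop := by
  have hmono : Monotone fun t => trials (pathHistory a y t) :=
    monotone_nat_of_le_succ fun t => by rw [trials_pathHistory_succ]; omega
  refine tendsto_atTop_atTop_of_monotone hmono fun b => ?_
  induction b with
  | zero => exact ⟨0, Nat.zero_le _⟩
  | succ b ih =>
    obtain ⟨t, ht⟩ := ih
    obtain ⟨u, hu, hau⟩ := (frequently_atTop.mp ha) t
    refine ⟨u + 1, ?_⟩
    have h1 := hmono hu
    simp only at h1 ⊢
    rw [trials_pathHistory_succ, if_pos hau]
    omega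

/-! ### Law of large numbers under adaptive sampling. -/

/-- Increment of the exponent of the exponential supermartingale of the innovation arm. -/
def tilt (p s : ℝ) (ay : Action × Outcome) : ℝ :=
  if ay.1 = .innovate then s * ((if ay.2 = true then 1 else 0) - p) - s ^ 2 else 0

theorem sum_tilt (p s : ℝ) (a : ℕ → Action) (y : ℕ → Outcome) (T : ℕ) :
    ∑ t ∈ Finset.range T, tilt p s (a t, y t) =
      s * (successes (pathHistory a y T) - p * trials (pathHistory a y T)) -
        s ^ 2 * trials (pathHistory a y T) := by
  induction T with
  | zero => simp [pathHistory, trials, successes, failures]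
  | succ T ih =>
    rw [Finset.sum_range_succ, ih, pathHistory_succ]
    unfold trials successes failures tilt
    rcases a T <;> rcases y T <;> simp [List.count_append] <;> ring

theorem exp_le_one_add_add_sq {x : ℝ} (hx : |x| ≤ 1) : Real.exp x ≤ 1 + x + x ^ 2 := by
  have := (abs_le.mp (Real.abs_exp_sub_one_sub_id_le hx)).2
  linarith

/-- The linear term of `exp x ≤ 1 + x + x ^ 2` has mean zero, and the quadratic term is `s ^ 2`
times the variance, which the `- s ^ 2` in the exponent absorbs. -/
theorem bernoulli_exp_tilt_le_one {p s : ℝ} (hp : p ∈ Set.Icc (0 : ℝ) 1) (hs : |s| ≤ 1) :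
    p * Real.exp (s * (1 - p) - s ^ 2) + (1 - p) * Real.exp (s * (0 - p) - s ^ 2) ≤ 1 := by
  obtain ⟨hp0, hp1⟩ := hp
  have hb : ∀ c : ℝ, |c| ≤ 1 → |s * c| ≤ 1 := fun c hc => by
    rw [abs_mul]; exact mul_le_one₀ hs (abs_nonneg _) hc
  have h1 := exp_le_one_add_add_sq (hb (1 - p) (abs_le.mpr ⟨by linarith, by linarith⟩))
  have h0 := exp_le_one_add_add_sq (hb (0 - p) (abs_le.mpr ⟨by linarith, by linarith⟩))
  have hvar : p * (1 - p) ≤ 1 := by nlinarith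
  have key : p * Real.exp (s * (1 - p)) + (1 - p) * Real.exp (s * (0 - p)) ≤ Real.exp (s ^ 2) :=
    calc p * Real.exp (s * (1 - p)) + (1 - p) * Real.exp (s * (0 - p))
        ≤ p * (1 + s * (1 - p) + (s * (1 - p)) ^ 2) +
          (1 - p) * (1 + s * (0 - p) + (s * (0 - p)) ^ 2) := by
          have : 0 ≤ 1 - p := by linarith
          gcongr
      _ = s ^ 2 * (p * (1 - p)) + 1 := by ring
      _ ≤ s ^ 2 + 1 := by nlinarith [sq_nonneg s]
      _ ≤ Real.exp (s ^ 2) := Real.add_one_le_exp _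
  rw [Real.exp_sub, Real.exp_sub, mul_div_assoc', mul_div_assoc', ← add_div]
  exact (div_le_one (Real.exp_pos _)).mpr key

variable {Ω : Type*} {mΩ : MeasurableSpace Ω} {P : Measure Ω}

/-- A nonnegative supermartingale is almost surely bounded along the path. -/
theorem ae_bddAbove_of_supermartingale_nonneg [IsFiniteMeasure P] {ℱ : Filtration ℕ mΩ}
    {Z : ℕ → Ω → ℝ}
    (hZ : Supermartingale Z ℱ P) (hpos : ∀ t ω, 0 ≤ Z t ω) :
    ∀ᵐ ω ∂P, ∃ C : ℝ, ∀ t, Z t ω ≤ C := by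
  -- The convergence theorem is applied to the submartingale `-Z`; nonnegativity turns its `L¹` norm
  -- into the mean of `Z n`, which cannot exceed that of `Z 0`.
  have hbdd : ∀ n, eLpNorm ((-Z) n) 1 P ≤ (Real.toNNReal (∫ ω, Z 0 ω ∂P) : ENNReal) := by
    intro n
    have hint : ∫ ω, Z n ω ∂P ≤ ∫ ω, Z 0 ω ∂P := by
      simpa using hZ.setIntegral_le (Nat.zero_le n) MeasurableSet.univ
    have heq : eLpNorm ((-Z) n) 1 P = ENNReal.ofReal (∫ ω, Z n ω ∂P) := by
      rw [Pi.neg_apply, eLpNorm_neg, eLpNorm_one_eq_lintegral_enorm,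
        ← ofReal_integral_norm_eq_lintegral_enorm (hZ.integrable n)]
      simp only [Real.norm_eq_abs, abs_of_nonneg (hpos n _)]
    rw [heq]
    exact ENNReal.ofReal_le_ofReal hint
  filter_upwards [hZ.neg.exists_ae_tendsto_of_bdd hbdd] with ω ⟨c, hc⟩
  obtain ⟨C, hC⟩ := hc.neg.bddAbove_range
  exact ⟨C, fun t => by simpa using hC (Set.mem_range_self t)⟩

theorem supermartingale_exp_sum_tilt [IsProbabilityMeasure P] {E : Env} {ℱ : Filtration ℕ mΩ}
    {a : ℕ → Ω → Action} {y : ℕ → Ω → Outcome} (hdata : IsDataGenerating E P ℱ a y)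
    {s : ℝ} (hs : |s| ≤ 1) :
    Supermartingale
      (fun T ω => Real.exp (∑ t ∈ Finset.range T, tilt (E.pstar .innovate) s (a t ω, y t ω)))
      ℱ P := by
  set p := E.pstar .innovate with hp
  set Z : ℕ → Ω → ℝ := fun T ω => Real.exp (∑ t ∈ Finset.range T, tilt p s (a t ω, y t ω)) with hZ
  obtain ⟨B, hB⟩ : ∃ B, ∀ ay, |tilt p s ay| ≤ B :=
    (Set.finite_range fun ay => |tilt p s ay|).bddAbove.imp fun B h ay => h (Set.mem_range_self ay)
  have hmeas : ∀ T, Measurable[ℱ T] (Z T) := fun T => by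
    refine Real.measurable_exp.comp (Finset.measurable_sum _ fun t ht => ?_)
    have ht' : t + 1 ≤ T := Finset.mem_range.mp ht
    exact (Measurable.of_discrete (f := tilt p s)).comp
      (((hdata.measurable_action t).mono (ℱ.mono (by omega)) le_rfl).prodMk
        ((hdata.measurable_outcome t).mono (ℱ.mono ht') le_rfl))
  have hbound : ∀ T ω, ‖Z T ω‖ ≤ Real.exp (T * B) := fun T ω => by
    rw [Real.norm_eq_abs, abs_of_pos (Real.exp_pos _)]
    refine Real.exp_le_exp.mpr ((Finset.sum_le_sum fun t _ => (le_abs_self _).trans (hB _)).trans ?_)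
    simp
  have hint : ∀ T, Integrable (Z T) P := fun T =>
    .of_bound (((hmeas T).mono (ℱ.le T) le_rfl).aestronglyMeasurable) _ (ae_of_all _ (hbound T))
  refine supermartingale_nat (fun T => (hmeas T).stronglyMeasurable) hint fun T => ?_
  set α : Action → ℝ := fun b => Real.exp (tilt p s (b, true)) - Real.exp (tilt p s (b, false))
  set β : Action → ℝ := fun b => Real.exp (tilt p s (b, false))
  set X : Ω → ℝ := fun ω => if y T ω = true then (1 : ℝ) else 0
  set F : Ω → ℝ := fun ω => Z T ω * α (a T ω)
  set G : Ω → ℝ := fun ω => Z T ω * β (a T ω)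
  have hFm : Measurable[ℱ T] F :=
    (hmeas T).mul ((Measurable.of_discrete (f := α)).comp (hdata.measurable_action T))
  have hGm : Measurable[ℱ T] G :=
    (hmeas T).mul ((Measurable.of_discrete (f := β)).comp (hdata.measurable_action T))
  have hXm : Measurable X := (Measurable.of_discrete (f := fun b : Outcome =>
    if b = true then (1 : ℝ) else 0)).comp ((hdata.measurable_outcome T).mono (ℱ.le _) le_rfl)
  have hX : Integrable X P := .of_bound hXm.aestronglyMeasurable 1
    (ae_of_all _ fun ω => by simp only [X]; split_ifs <;> simp)
  have hprod : ∀ φ : Action → ℝ, ∃ C, ∀ ω, ‖Z T ω * φ (a T ω)‖ ≤ C := fun φ => by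
    obtain ⟨C, hC⟩ := (Set.finite_range fun b => ‖φ b‖).bddAbove
    refine ⟨Real.exp (T * B) * C, fun ω => ?_⟩
    rw [norm_mul]
    exact mul_le_mul (hbound T ω) (hC (Set.mem_range_self _)) (norm_nonneg _) (Real.exp_pos _).le
  obtain ⟨CF, hCF⟩ := hprod α
  obtain ⟨CG, hCG⟩ := hprod β
  have hG : Integrable G P :=
    .of_bound ((hGm.mono (ℱ.le T) le_rfl).aestronglyMeasurable) CG (ae_of_all _ hCG)
  have hFX : Integrable (F * X) P :=
    hX.bdd_mul ((hFm.mono (ℱ.le T) le_rfl).aestronglyMeasurable) (ae_of_all _ hCF)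
  -- A function of a binary outcome is affine in the success indicator `X`, so the conditional law
  -- enters only through the conditional mean of `X`.
  have hstep : Z (T + 1) = F * X + G := by
    funext ω
    simp only [Z, F, X, G, α, β, Pi.add_apply, Pi.mul_apply, Finset.sum_range_succ, Real.exp_add]
    rcases y T ω <;> (simp; try ring)
  rw [hstep]
  filter_upwards [condExp_add hFX hG (ℱ T),
    condExp_mul_of_stronglyMeasurable_left hFm.stronglyMeasurable hFX hX,
    hdata.outcome_law T] with ω h1 h2 h3
  rw [h1, Pi.add_apply, h2, condExp_of_stronglyMeasurable (ℱ.le T) hGm.stronglyMeasurable hG,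
    Pi.mul_apply, h3]
  have hle : α (a T ω) * E.pstar (a T ω) + β (a T ω) ≤ 1 := by
    rcases a T ω with _ | _
    · simp [α, β, tilt]
    · have := bernoulli_exp_tilt_le_one (hp ▸ E.pstar_mem .innovate) hs
      simp only [α, β, tilt, ← hp]
      simp only [if_true, Bool.false_eq_true, if_false]
      linarith
  calc F ω * E.pstar (a T ω) + G ω = Z T ω * (α (a T ω) * E.pstar (a T ω) + β (a T ω)) := by
        simp only [F, G]; ring
    _ ≤ Z T ω * 1 := mul_le_mul_of_nonneg_left hle (Real.exp_pos _).le
    _ = Z T ω := mul_one _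

/-- Deviations of the success count are at most `|s|` per trial, up to a constant. -/
theorem ae_successes_bound [IsProbabilityMeasure P] {E : Env} {ℱ : Filtration ℕ mΩ}
    {a : ℕ → Ω → Action} {y : ℕ → Ω → Outcome} (hdata : IsDataGenerating E P ℱ a y)
    {s : ℝ} (hs : |s| ≤ 1) :
    ∀ᵐ ω ∂P, ∃ C : ℝ, ∀ t,
      s * (successes (pathHistory (a · ω) (y · ω) t) -
        E.pstar .innovate * trials (pathHistory (a · ω) (y · ω) t)) ≤
      s ^ 2 * trials (pathHistory (a · ω) (y · ω) t) + C := by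
  filter_upwards [ae_bddAbove_of_supermartingale_nonneg (supermartingale_exp_sum_tilt hdata hs)
    fun t ω => (Real.exp_pos _).le] with ω ⟨C, hC⟩
  refine ⟨C, fun t => ?_⟩
  have h := (Real.add_one_le_exp _).trans (hC t)
  rw [sum_tilt (E.pstar .innovate) s (a · ω) (y · ω)] at h
  linarith

/-- Strong law of large numbers for the innovation arm under adaptive sampling. -/
theorem ae_tendsto_successRate [IsProbabilityMeasure P] {E : Env} {ℱ : Filtration ℕ mΩ}
    {a : ℕ → Ω → Action} {y : ℕ → Ω → Outcome} (hdata : IsDataGenerating E P ℱ a y) :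
    ∀ᵐ ω ∂P, (∃ᶠ t in atTop, a t ω = .innovate) →
      Tendsto (fun t => successRate (pathHistory (a · ω) (y · ω) t)) atTop
        (𝓝 (E.pstar .innovate)) := by
  have hpos : ∀ n : ℕ, |1 / ((n : ℝ) + 1)| ≤ 1 := fun n => by
    rw [abs_of_nonneg (by positivity), div_le_one (by positivity)]
    linarith [n.cast_nonneg (α := ℝ)]
  -- Countably many slopes `±1 / (n + 1)` keep the exceptional set null while allowing `s` to be
  -- arbitrarily small.
  have h1 := ae_all_iff.mpr fun n : ℕ => ae_successes_bound hdata (hpos n)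
  have h2 := ae_all_iff.mpr fun n : ℕ =>
    ae_successes_bound hdata (s := -(1 / ((n : ℝ) + 1))) (by rw [abs_neg]; exact hpos n)
  filter_upwards [h1, h2] with ω h1 h2 hfreq
  have hN := tendsto_trials_atTop (a · ω) (y · ω) hfreq
  rw [Metric.tendsto_atTop']
  intro ε hε
  obtain ⟨n, hn⟩ := exists_nat_one_div_lt (half_pos hε)
  obtain ⟨C₁, hC₁⟩ := h1 n
  obtain ⟨C₂, hC₂⟩ := h2 n
  set s : ℝ := 1 / ((n : ℝ) + 1)
  have hs0 : 0 < s := by positivity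
  have hN' : Tendsto (fun t => (trials (pathHistory (a · ω) (y · ω) t) : ℝ)) atTop atTop :=
    tendsto_natCast_atTop_atTop.comp hN
  -- With `N` trials the deviation is at most `s N + C / s`; the choice of `s` makes the first term
  -- at most `ε N / 2`, and this threshold on `N` does the same for the second.
  obtain ⟨t₀, ht₀⟩ := eventually_atTop.mp ((hN'.eventually_gt_atTop 0).and
    (hN'.eventually_gt_atTop ((|C₁| + |C₂|) / (s * (ε / 2)))))
  refine ⟨t₀, fun t ht => ?_⟩
  obtain ⟨hpos, hbig⟩ := ht₀ t ht.le
  have e1 := hC₁ t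
  have e2 := hC₂ t
  rw [div_lt_iff₀ (by positivity)] at hbig
  rw [Real.dist_eq, successRate]
  set N : ℝ := (trials (pathHistory (a · ω) (y · ω) t) : ℝ)
  set S : ℝ := (successes (pathHistory (a · ω) (y · ω) t) : ℝ)
  set p := E.pstar .innovate
  have hdiff : S / N - p = (S - p * N) / N := by field_simp
  rw [hdiff, abs_div, abs_of_pos hpos, div_lt_iff₀ hpos, abs_lt]
  have hsN : s * N ≤ ε / 2 * N := by gcongr
  have hC1 := le_abs_self C₁
  have hC2 := le_abs_self C₂
  have hn1 := abs_nonneg C₁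
  have hn2 := abs_nonneg C₂
  constructor
  · refine lt_of_mul_lt_mul_left ?_ hs0.le
    nlinarith
  · refine lt_of_mul_lt_mul_left ?_ hs0.le
    nlinarith

/-! ### Likelihoods, empirical frequencies and divergences. -/

/-- The likelihood splits into a part for the safe action and a part for innovation. -/
theorem likelihood_eq (r : Action → ℝ) (h : PrivateHistory) :
    likelihood r h =
      r .safe ^ h.count (.safe, true) * (1 - r .safe) ^ h.count (.safe, false) *
        (r .innovate ^ successes h * (1 - r .innovate) ^ failures h) := by
  unfold likelihood successes failures
  induction h with
  | nil => simp
  | cons ay h ih =>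
    rw [List.map_cons, List.prod_cons, ih]
    obtain ⟨_ | _, _ | _⟩ := ay <;> simp [bern, pow_succ] <;> ring

theorem successRate_mem_Icc (h : PrivateHistory) : successRate h ∈ Set.Icc (0 : ℝ) 1 := by
  refine ⟨by unfold successRate; positivity, div_le_one_of_le₀ ?_ (Nat.cast_nonneg _)⟩
  exact_mod_cast Nat.le_add_right _ _

theorem successes_eq (h : PrivateHistory) : (successes h : ℝ) = trials h * successRate h := by
  unfold successRate
  rcases Nat.eq_zero_or_pos (trials h) with h0 | h0
  · have : successes h = 0 := by unfold trials at h0; omega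
    simp [h0, this]
  · have : (trials h : ℝ) ≠ 0 := by positivity
    field_simp

theorem failures_eq (h : PrivateHistory) :
    (failures h : ℝ) = trials h * (1 - successRate h) := by
  have h1 := successes_eq h
  have h2 : (trials h : ℝ) = successes h + failures h := by simp [trials]
  linarith

/-- A base vanishes only when its exponent does, and `0 ^ 0 = 1`. This keeps logarithms of empirical
likelihoods valid at boundary frequencies and with no trials. -/
theorem successRate_pow_ne_zero (h : PrivateHistory) :
    successRate h ^ successes h ≠ 0 ∧ (1 - successRate h) ^ failures h ≠ 0 := by
  constructor
  · intro h0
    obtain ⟨hr, hs⟩ := pow_eq_zero_iff'.mp h0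
    exact hs (Nat.cast_eq_zero.mp ((successes_eq h).trans (by rw [hr, mul_zero])))
  · intro h0
    obtain ⟨hr, hs⟩ := pow_eq_zero_iff'.mp h0
    exact hs (Nat.cast_eq_zero.mp ((failures_eq h).trans (by rw [hr, mul_zero])))

theorem klDivergence_bern {x θ : ℝ} (h0 : 0 < θ) (h1 : θ < 1) :
    klDivergence (bern x) (bern θ) =
      x * Real.log x + (1 - x) * Real.log (1 - x) -
        (x * Real.log θ + (1 - x) * Real.log (1 - θ)) := by
  have key : ∀ u v : ℝ, 0 < v → u * Real.log (u / v) = u * Real.log u - u * Real.log v := by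
    intro u v hv
    rcases eq_or_ne u 0 with rfl | hu
    · simp
    · rw [Real.log_div hu hv.ne', mul_sub]
  simp only [klDivergence, Fintype.sum_bool, bern]
  rw [key _ _ h0, key _ _ (sub_pos.mpr h1)]
  ring

theorem continuous_klDivergence_bern {θ : ℝ} (h0 : 0 < θ) (h1 : θ < 1) :
    Continuous fun x => klDivergence (bern x) (bern θ) := by
  simp only [klDivergence_bern h0 h1]
  have hc := Real.continuous_mul_log
  have hc' : Continuous fun x : ℝ => (1 - x) * Real.log (1 - x) :=
    hc.comp (continuous_const.sub continuous_id)
  fun_prop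

namespace Env

variable (E : Env)

theorem p_pos : 0 < E.p := E.θL_pos.trans E.θL_lt_p

theorem p_lt_one : E.p < 1 := E.p_lt_θH.trans E.θH_lt_one

theorem theta_pos (j : Model) : 0 < E.theta j := by
  cases j
  exacts [E.θL_pos, E.p_pos.trans E.p_lt_θH]

theorem theta_lt_one (j : Model) : E.theta j < 1 := by
  cases j
  exacts [E.θL_lt_p.trans E.p_lt_one, E.θH_lt_one]

theorem prior_pos (j : Model) : 0 < E.prior j := by
  cases j
  exacts [sub_pos.mpr E.m_lt_one, E.m_pos]

theorem likelihood_model_pos (j : Model) (h : PrivateHistory) : 0 < likelihood (E.model j) h := by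
  rw [likelihood_eq]
  have h1 := E.p_pos
  have h2 := sub_pos.mpr E.p_lt_one
  have h3 := E.theta_pos j
  have h4 := sub_pos.mpr (E.theta_lt_one j)
  simp only [model]
  positivity

/-- The structured success probability of the safe action with the empirical one of innovation. -/
def empiricalModel (h : PrivateHistory) : Action → ℝ
  | .safe => E.p
  | .innovate => successRate h

theorem empiricalModel_mem_Icc (h : PrivateHistory) (a : Action) :
    E.empiricalModel h a ∈ Set.Icc (0 : ℝ) 1 := by
  cases a
  exacts [⟨E.p_pos.le, E.p_lt_one.le⟩, successRate_mem_Icc h]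

theorem likelihood_empiricalModel_pos (h : PrivateHistory) :
    0 < likelihood (E.empiricalModel h) h := by
  rw [likelihood_eq]
  have h1 := E.p_pos
  have h2 := sub_pos.mpr E.p_lt_one
  obtain ⟨h3, h4⟩ := successRate_pow_ne_zero h
  obtain ⟨h5, h6⟩ := successRate_mem_Icc h
  have h3' := lt_of_le_of_ne (pow_nonneg h5 _) h3.symm
  have h4' := lt_of_le_of_ne (pow_nonneg (sub_nonneg.mpr h6) _) h4.symm
  simp only [empiricalModel]
  positivity

/-- Both models give the safe action probability `p`, so safe observations cancel and only
innovation data remain. -/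
theorem log_likelihood_empiricalModel_sub (j : Model) (h : PrivateHistory) :
    Real.log (likelihood (E.empiricalModel h) h) - Real.log (likelihood (E.model j) h) =
      trials h * klDivergence (bern (successRate h)) (bern (E.theta j)) := by
  have h1 := E.p_pos
  have h2 := sub_pos.mpr E.p_lt_one
  have h3 := E.theta_pos j
  have h4 := sub_pos.mpr (E.theta_lt_one j)
  obtain ⟨h5, h6⟩ := successRate_pow_ne_zero h
  rw [likelihood_eq, likelihood_eq, klDivergence_bern h3 (E.theta_lt_one j)]
  simp only [empiricalModel, model]
  have h7 : E.p ^ h.count (.safe, true) * (1 - E.p) ^ h.count (.safe, false) ≠ 0 := by positivity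
  have h8 := pow_ne_zero (successes h) h3.ne'
  have h9 := pow_ne_zero (failures h) h4.ne'
  rw [Real.log_mul h7 (mul_ne_zero h5 h6), Real.log_mul h5 h6, Real.log_mul h7 (mul_ne_zero h8 h9),
    Real.log_mul h8 h9]
  simp only [Real.log_pow, successes_eq, failures_eq]
  ring

theorem likelihood_le_one {r : Action → ℝ} (hr : ∀ a, r a ∈ Set.Icc (0 : ℝ) 1)
    (h : PrivateHistory) : likelihood r h ≤ 1 := by
  have h1 := hr .safe
  have h2 := hr .innovate
  have key : ∀ {u : ℝ} (m n : ℕ), u ∈ Set.Icc (0 : ℝ) 1 →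
      0 ≤ u ^ m * (1 - u) ^ n ∧ u ^ m * (1 - u) ^ n ≤ 1 := by
    intro u m n ⟨h0, h1⟩
    have h0' := sub_nonneg.mpr h1
    exact ⟨by positivity, mul_le_one₀ (pow_le_one₀ h0 h1) (by positivity)
      (pow_le_one₀ h0' (by linarith))⟩
  rw [likelihood_eq]
  exact mul_le_one₀ (key _ _ h1).2 (key _ _ h2).1 (key _ _ h2).2

/-- The log-likelihood ratio is at least the empirical divergence of innovation data from the
likeliest structured model. -/
theorem exists_le_LLR (h : PrivateHistory) :
    ∃ j, trials h * klDivergence (bern (successRate h)) (bern (E.theta j)) ≤ E.LLR h := by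
  obtain ⟨j, hj⟩ := exists_eq_ciSup_of_finite (f := fun j => likelihood (E.model j) h)
  refine ⟨j, ?_⟩
  have hsup : likelihood (E.empiricalModel h) h ≤
      ⨆ r : Action → Set.Icc (0 : ℝ) 1, likelihood (fun a => (r a : ℝ)) h :=
    le_ciSup (f := fun r : Action → Set.Icc (0 : ℝ) 1 => likelihood (fun a => (r a : ℝ)) h)
      ⟨1, by rintro _ ⟨r, rfl⟩; exact likelihood_le_one (fun a => (r a).2) h⟩
      (fun a => ⟨E.empiricalModel h a, E.empiricalModel_mem_Icc h a⟩)
  have hpos := E.likelihood_empiricalModel_pos h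
  rw [LLR, ← hj, Real.log_div (E.likelihood_model_pos j h).ne' (hpos.trans_le hsup).ne',
    ← log_likelihood_empiricalModel_sub]
  linarith [Real.log_le_log hpos hsup]

theorem posterior_nonneg (h : PrivateHistory) (j : Model) : 0 ≤ E.posterior h j :=
  div_nonneg (mul_nonneg (E.prior_pos j).le (E.likelihood_model_pos j h).le)
    (Finset.sum_nonneg fun i _ => mul_nonneg (E.prior_pos i).le (E.likelihood_model_pos i h).le)

theorem sum_posterior (h : PrivateHistory) : ∑ j, E.posterior h j = 1 := by
  unfold posterior
  rw [← Finset.sum_div, div_self]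
  exact (Finset.sum_pos (fun i _ => mul_pos (E.prior_pos i) (E.likelihood_model_pos i h))
    Finset.univ_nonempty).ne'

/-- Posterior odds between two structured models. -/
def odds (i j : Model) (h : PrivateHistory) : ℝ :=
  E.prior i * likelihood (E.model i) h / (E.prior j * likelihood (E.model j) h)

theorem posterior_le_odds (h : PrivateHistory) (i j : Model) :
    E.posterior h i ≤ E.odds i j h :=
  div_le_div_of_nonneg_left (mul_pos (E.prior_pos i) (E.likelihood_model_pos i h)).le
    (mul_pos (E.prior_pos j) (E.likelihood_model_pos j h))
    (Finset.single_le_sum (f := fun i => E.prior i * likelihood (E.model i) h)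
      (fun i _ => (mul_pos (E.prior_pos i) (E.likelihood_model_pos i h)).le) (Finset.mem_univ j))

/-- Comparing both models with the same empirical model cancels its likelihood. A strict divergence
gap then drives the odds to zero exponentially in the number of trials. -/
theorem odds_eq (h : PrivateHistory) (i j : Model) :
    E.odds i j h = E.prior i / E.prior j *
      Real.exp (trials h * (klDivergence (bern (successRate h)) (bern (E.theta j)) -
        klDivergence (bern (successRate h)) (bern (E.theta i)))) := by
  have hexp : (trials h * (klDivergence (bern (successRate h)) (bern (E.theta j)) -
        klDivergence (bern (successRate h)) (bern (E.theta i)))) =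
      Real.log (likelihood (E.model i) h) - Real.log (likelihood (E.model j) h) := by
    rw [mul_sub, ← log_likelihood_empiricalModel_sub, ← log_likelihood_empiricalModel_sub]
    ring
  rw [hexp, Real.exp_sub, Real.exp_log (E.likelihood_model_pos i h),
    Real.exp_log (E.likelihood_model_pos j h), div_mul_div_comm, odds]

/-! ### One-step advantage of innovation. -/

/-- `exp (k * λ̄_k)` is exactly the largest safe-to-innovation likelihood ratio: it is attained at
success for `q_L` and at failure for `q_H`. -/
theorem bern_safe_le (j : Model) (y : Outcome) :
    bern E.p y ≤ Real.exp (E.k * E.lambdaBar j) * bern (E.theta j) y := by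
  have hp := E.p_pos
  have hp1 := sub_pos.mpr E.p_lt_one
  have hk := E.k_pos.ne'
  have hL := E.θL_pos
  have hH := sub_pos.mpr E.θH_lt_one
  have hLp := E.θL_lt_p
  have hpH := E.p_lt_θH
  cases j
  · have : Real.exp (E.k * E.lambdaBar .low) = E.p / E.θL := by
      rw [lambdaBar, ← mul_assoc, mul_one_div_cancel hk, one_mul, Real.exp_log (by positivity)]
    rw [this, div_mul_eq_mul_div, le_div_iff₀ hL]
    cases y <;> simp only [bern, theta] <;> nlinarith
  · have : Real.exp (E.k * E.lambdaBar .high) = (1 - E.p) / (1 - E.θH) := by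
      rw [lambdaBar, ← mul_assoc, mul_one_div_cancel hk, one_mul, Real.exp_log (by positivity)]
    rw [this, div_mul_eq_mul_div, le_div_iff₀ hH]
    cases y <;> simp only [bern, theta] <;> nlinarith

theorem lambdaBar_pos (j : Model) : 0 < E.lambdaBar j := by
  have hk := E.k_pos
  have h1 := E.θL_pos
  have h2 := E.θL_lt_p
  have h3 := E.p_lt_θH
  have h4 := E.θH_lt_one
  cases j
  · exact mul_pos (by positivity) (Real.log_pos ((one_lt_div h1).mpr h2))
  · exact mul_pos (by positivity) (Real.log_pos ((one_lt_div (by linarith)).mpr (by linarith)))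

/-- Innovation beats the safe action within a model by at most `k * λ̄_k / λ`, whatever the
payoffs. -/
theorem robustValue_innovate_sub_safe_le (j : Model) (z : Outcome → ℝ) {lam : ℝ} (hlam : 0 < lam) :
    robustValue (bern (E.model j .innovate)) z lam - robustValue (bern (E.model j .safe)) z lam ≤
      E.k * E.lambdaBar j / lam := by
  have hposθ : 0 < ∑ y, bern (E.theta j) y * Real.exp (-lam * z y) := by
    rw [Fintype.sum_bool]
    exact add_pos (mul_pos (E.theta_pos j) (Real.exp_pos _))
      (mul_pos (sub_pos.mpr (E.theta_lt_one j)) (Real.exp_pos _))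
  have hposp : 0 < ∑ y, bern E.p y * Real.exp (-lam * z y) := by
    rw [Fintype.sum_bool]
    exact add_pos (mul_pos E.p_pos (Real.exp_pos _))
      (mul_pos (sub_pos.mpr E.p_lt_one) (Real.exp_pos _))
  have hle : ∑ y, bern E.p y * Real.exp (-lam * z y) ≤
      Real.exp (E.k * E.lambdaBar j) * ∑ y, bern (E.theta j) y * Real.exp (-lam * z y) := by
    rw [Finset.mul_sum]
    refine Finset.sum_le_sum fun y _ => ?_
    rw [← mul_assoc]
    exact mul_le_mul_of_nonneg_right (E.bern_safe_le j y) (Real.exp_pos _).le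
  have hlog := Real.log_le_log hposp hle
  rw [Real.log_mul (Real.exp_pos _).ne' hposθ.ne', Real.log_exp] at hlog
  simp only [robustValue, if_neg hlam.ne', model]
  rw [← mul_sub_left_distrib, neg_mul, one_div_mul_eq_div, ← neg_div]
  gcongr
  linarith

end Env

/-! ### Lipschitz bounds for the robust valuation -/

theorem log_sum_bern_exp_le {θ : ℝ} (h0 : 0 < θ) (h1 : θ < 1) {w w' : Outcome → ℝ} {c : ℝ}
    (hw : ∀ y, w y ≤ w' y + c) :
    Real.log (∑ y, bern θ y * Real.exp (w y)) ≤ Real.log (∑ y, bern θ y * Real.exp (w' y)) + c := by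
  have hpos : ∀ (v : Outcome → ℝ), 0 < ∑ y, bern θ y * Real.exp (v y) := fun v => by
    rw [Fintype.sum_bool]
    exact add_pos (mul_pos h0 (Real.exp_pos _)) (mul_pos (sub_pos.mpr h1) (Real.exp_pos _))
  have hb : ∀ y, 0 ≤ bern θ y := fun y => by cases y <;> simp only [bern] <;> linarith
  have hle : ∑ y, bern θ y * Real.exp (w y) ≤ (∑ y, bern θ y * Real.exp (w' y)) * Real.exp c := by
    rw [Finset.sum_mul]
    refine Finset.sum_le_sum fun y _ => ?_
    rw [mul_assoc, ← Real.exp_add]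
    exact mul_le_mul_of_nonneg_left (Real.exp_le_exp.mpr (hw y)) (hb y)
  have := Real.log_le_log (hpos w) hle
  rwa [Real.log_mul (hpos w').ne' (Real.exp_pos _).ne', Real.log_exp] at this

theorem abs_log_sum_bern_exp_sub_le {θ : ℝ} (h0 : 0 < θ) (h1 : θ < 1) {w w' : Outcome → ℝ} {c : ℝ}
    (hw : ∀ y, |w y - w' y| ≤ c) :
    |Real.log (∑ y, bern θ y * Real.exp (w y)) - Real.log (∑ y, bern θ y * Real.exp (w' y))|
      ≤ c := by
  rw [abs_sub_le_iff]
  constructor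
  · have := log_sum_bern_exp_le h0 h1 (w := w) (w' := w') (c := c)
      fun y => by linarith [(abs_le.mp (hw y)).2]
    linarith
  · have := log_sum_bern_exp_le h0 h1 (w := w') (w' := w) (c := c)
      fun y => by linarith [(abs_le.mp (hw y)).1]
    linarith

theorem mul_robustValue (q z : Outcome → ℝ) {lam : ℝ} (hlam : 0 < lam) :
    lam * robustValue q z lam = -Real.log (∑ y, q y * Real.exp (-lam * z y)) := by
  rw [robustValue, if_neg hlam.ne']
  field_simp

theorem abs_robustValue_sub_le {θ : ℝ} (h0 : 0 < θ) (h1 : θ < 1) {z z' : Outcome → ℝ} {lam c : ℝ}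
    (hlam : 0 < lam) (hz : ∀ y, |z y - z' y| ≤ c) :
    |robustValue (bern θ) z lam - robustValue (bern θ) z' lam| ≤ c := by
  have key := abs_log_sum_bern_exp_sub_le h0 h1 (w := fun y => -lam * z' y)
    (w' := fun y => -lam * z y) (c := lam * c) fun y => by
      rw [show -lam * z' y - -lam * z y = lam * (z y - z' y) by ring, abs_mul, abs_of_pos hlam]
      exact mul_le_mul_of_nonneg_left (hz y) hlam.le
  refine le_of_mul_le_mul_left ?_ hlam
  rw [← abs_of_pos hlam, ← abs_mul, abs_of_pos hlam, mul_sub, mul_robustValue _ _ hlam,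
    mul_robustValue _ _ hlam]
  rwa [neg_sub_neg]

theorem abs_robustValue_le {θ : ℝ} (h0 : 0 < θ) (h1 : θ < 1) {z : Outcome → ℝ} {lam Z : ℝ}
    (hlam : 0 < lam) (hz : ∀ y, |z y| ≤ Z) : |robustValue (bern θ) z lam| ≤ Z := by
  have := abs_robustValue_sub_le h0 h1 (z := z) (z' := fun _ => 0) hlam (c := Z) (by simpa using hz)
  have h0 : robustValue (bern θ) (fun _ => 0) lam = 0 := by simp [robustValue, bern]
  rwa [h0, sub_zero] at this

/-- The product of `λ` and the robust value is Lipschitz in `λ` with constant `Z`; dividing by `λ`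
costs the factor `1 / l`, which is why the concern must stay away from zero. -/
theorem abs_robustValue_sub_robustValue_le {θ : ℝ} (h0 : 0 < θ) (h1 : θ < 1) {z : Outcome → ℝ}
    {l lam lam' Z : ℝ} (hl : 0 < l) (hlam : l ≤ lam) (hlam' : l ≤ lam') (hz : ∀ y, |z y| ≤ Z) :
    |robustValue (bern θ) z lam - robustValue (bern θ) z lam'| ≤ 2 * Z * |lam - lam'| / l := by
  have hp := hl.trans_le hlam
  have hp' := hl.trans_le hlam'
  have key := abs_log_sum_bern_exp_sub_le h0 h1 (w := fun y => -lam' * z y)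
    (w' := fun y => -lam * z y) (c := |lam - lam'| * Z) fun y => by
      rw [show -lam' * z y - -lam * z y = (lam - lam') * z y by ring, abs_mul]
      exact mul_le_mul_of_nonneg_left (hz y) (abs_nonneg _)
  rw [← neg_sub_neg, ← mul_robustValue _ _ hp, ← mul_robustValue _ _ hp'] at key
  have hg := abs_robustValue_le h0 h1 hp' hz
  set g := robustValue (bern θ) z lam
  set g' := robustValue (bern θ) z lam'
  rw [le_div_iff₀ hl]
  calc |g - g'| * l ≤ |g - g'| * lam := mul_le_mul_of_nonneg_left hlam (abs_nonneg _)
    _ = |(lam * g - lam' * g') - (lam - lam') * g'| := by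
        rw [← abs_of_pos hp, ← abs_mul, abs_of_pos hp]; congr 1; ring
    _ ≤ |lam * g - lam' * g'| + |(lam - lam') * g'| := abs_sub _ _
    _ ≤ |lam - lam'| * Z + |lam - lam'| * Z := by
        rw [abs_mul (lam - lam')]
        gcongr
    _ = 2 * Z * |lam - lam'| := by ring

namespace Env

variable (E : Env)

theorem model_pos (j : Model) (a : Action) : 0 < E.model j a := by
  cases a
  exacts [E.p_pos, E.theta_pos j]

theorem model_lt_one (j : Model) (a : Action) : E.model j a < 1 := by
  cases a
  exacts [E.p_lt_one, E.theta_lt_one j]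

theorem abs_aggregator_sub_le (a : Action) {z z' : Outcome → ℝ} {μ μ' : Model → ℝ}
    {l lam lam' c Z : ℝ} (hμ : ∀ j, 0 ≤ μ j) (hμ1 : ∑ j, μ j = 1) (hl : 0 < l) (hlam : l ≤ lam)
    (hlam' : l ≤ lam') (hz : ∀ y, |z y - z' y| ≤ c) (hz' : ∀ y, |z' y| ≤ Z) :
    |E.aggregator a z μ lam - E.aggregator a z' μ' lam'| ≤
      c + 2 * Z * |lam - lam'| / l + Z * ∑ j, |μ j - μ' j| := by
  have hp := hl.trans_le hlam
  have hp' := hl.trans_le hlam'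
  set g := fun j => robustValue (bern (E.model j a)) z lam with hg
  set g' := fun j => robustValue (bern (E.model j a)) z' lam' with hg'
  have hgg : ∀ j, |g j - g' j| ≤ c + 2 * Z * |lam - lam'| / l := fun j =>
    (abs_sub_le _ (robustValue (bern (E.model j a)) z' lam) _).trans <| add_le_add
      (abs_robustValue_sub_le (E.model_pos j a) (E.model_lt_one j a) hp hz)
      (abs_robustValue_sub_robustValue_le (E.model_pos j a) (E.model_lt_one j a) hl hlam hlam' hz')
  have hgZ : ∀ j, |g' j| ≤ Z := fun j =>
    abs_robustValue_le (E.model_pos j a) (E.model_lt_one j a) hp' hz'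
  have hsplit : E.aggregator a z μ lam - E.aggregator a z' μ' lam' =
      ∑ j, μ j * (g j - g' j) + ∑ j, (μ j - μ' j) * g' j := by
    simp only [aggregator, ← Finset.sum_sub_distrib, ← Finset.sum_add_distrib, hg, hg']
    exact Finset.sum_congr rfl fun j _ => by ring
  rw [hsplit]
  refine (abs_add_le _ _).trans (add_le_add ?_ ?_)
  · calc |∑ j, μ j * (g j - g' j)| ≤ ∑ j, |μ j * (g j - g' j)| := Finset.abs_sum_le_sum_abs _ _
      _ ≤ ∑ j, μ j * (c + 2 * Z * |lam - lam'| / l) := Finset.sum_le_sum fun j _ => by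
          rw [abs_mul, abs_of_nonneg (hμ j)]
          exact mul_le_mul_of_nonneg_left (hgg j) (hμ j)
      _ = _ := by rw [← Finset.sum_mul, hμ1, one_mul]
  · calc |∑ j, (μ j - μ' j) * g' j| ≤ ∑ j, |(μ j - μ' j) * g' j| := Finset.abs_sum_le_sum_abs _ _
      _ ≤ ∑ j, Z * |μ j - μ' j| := Finset.sum_le_sum fun j _ => by
          rw [abs_mul, mul_comm]
          exact mul_le_mul_of_nonneg_right (hgZ j) (abs_nonneg _)
      _ = _ := by rw [← Finset.mul_sum]

/-! ### Sensitivity of continuation values to the private history. -/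

variable {E} {x : Contract} {W : PrivateHistory → ℝ} {Bx B : ℝ}

theorem abs_payoff_le (hx : ∀ s y, |x s y| ≤ Bx) (hB : ∀ h, |W h| ≤ B)
    (s : PublicHistory) (h : PrivateHistory) (y : Outcome) :
    |x s y + E.δ * W h| ≤ Bx + B := by
  refine (abs_add_le _ _).trans (add_le_add (hx _ _) ?_)
  rw [abs_mul, abs_of_pos E.δ_pos]
  exact (mul_le_of_le_one_left (abs_nonneg _) E.δ_lt_one.le).trans (hB h)

theorem publicPart_append (h u : PrivateHistory) :
    publicPart (h ++ u) = publicPart h ++ publicPart u := by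
  simp [publicPart]

/-- Continuation values at two nearby private histories with the same public history are close, if
the agent's state moves little over the next `n` periods. -/
theorem abs_continuationValue_sub_le (hx : ∀ s y, |x s y| ≤ Bx) (hB : ∀ h, |W h| ≤ B)
    (hW : ∀ h, W h = max (E.actionValue x W h .safe) (E.actionValue x W h .innovate))
    (h₀ : PrivateHistory) {n : ℕ} {l ρ κ : ℝ} (hl : 0 < l)
    (hlow : ∀ u : PrivateHistory, u.length ≤ n → l ≤ E.concern (h₀ ++ u))
    (hconc : ∀ u u' : PrivateHistory, u.length = u'.length → u.length ≤ n →
      |E.concern (h₀ ++ u) - E.concern (h₀ ++ u')| ≤ ρ)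
    (hpost : ∀ u u' : PrivateHistory, u.length = u'.length → u.length ≤ n →
      ∑ j, |E.posterior (h₀ ++ u) j - E.posterior (h₀ ++ u') j| ≤ κ) (m : ℕ) :
    ∀ u u' : PrivateHistory, u.length = u'.length → publicPart u = publicPart u' →
      u.length + m ≤ n →
      |W (h₀ ++ u) - W (h₀ ++ u')| ≤
        (2 * (Bx + B) * ρ / l + (Bx + B) * κ) / (1 - E.δ) + E.δ ^ m * (2 * B) := by
  have hδ := sub_pos.mpr E.δ_lt_one
  have hZ : 0 ≤ Bx + B :=
    (abs_nonneg _).trans (abs_payoff_le (E := E) hx hB [] [] true)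
  -- The one-period discrepancy caused by the state. Its discounted sum is `η / (1 - δ)`, and the
  -- crude bound `2 B` is used only after `m` periods.
  set η := 2 * (Bx + B) * ρ / l + (Bx + B) * κ with hη
  have hη0 : 0 ≤ η := by
    have h1 := (abs_nonneg _).trans (hconc [] [] rfl (Nat.zero_le _))
    have h2 := (Finset.sum_nonneg fun _ _ => abs_nonneg _).trans (hpost [] [] rfl (Nat.zero_le _))
    positivity
  induction m with
  | zero =>
    intro u u' _ _ _
    have h1 := (abs_sub _ _).trans (add_le_add (hB (h₀ ++ u)) (hB (h₀ ++ u')))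
    have h2 : 0 ≤ η / (1 - E.δ) := by positivity
    linarith
  | succ m ih =>
    intro u u' hlen hpub hn
    have hstep : ∀ a, |E.actionValue x W (h₀ ++ u) a - E.actionValue x W (h₀ ++ u') a| ≤
        η / (1 - E.δ) + E.δ ^ (m + 1) * (2 * B) := by
      intro a
      have hz : ∀ y, |(x (publicPart (h₀ ++ u)) y + E.δ * W (h₀ ++ u ++ [(a, y)])) -
          (x (publicPart (h₀ ++ u')) y + E.δ * W (h₀ ++ u' ++ [(a, y)]))| ≤
          E.δ * (η / (1 - E.δ) + E.δ ^ m * (2 * B)) := by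
        intro y
        rw [publicPart_append, publicPart_append, hpub, add_sub_add_left_eq_sub, ← mul_sub, abs_mul,
          abs_of_pos E.δ_pos, List.append_assoc, List.append_assoc]
        refine mul_le_mul_of_nonneg_left (ih _ _ (by simp [hlen]) ?_ ?_) E.δ_pos.le
        · rw [publicPart_append, publicPart_append, hpub]
        · simp; omega
      have hagg := E.abs_aggregator_sub_le a (μ' := E.posterior (h₀ ++ u'))
        (E.posterior_nonneg (h₀ ++ u)) (E.sum_posterior (h₀ ++ u)) hl
        (hlow u (by omega)) (hlow u' (by omega)) hz (fun y => abs_payoff_le hx hB _ _ y)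
      simp only [actionValue, sub_sub_sub_cancel_right]
      refine hagg.trans ?_
      have h1 : 2 * (Bx + B) * |E.concern (h₀ ++ u) - E.concern (h₀ ++ u')| / l ≤
          2 * (Bx + B) * ρ / l := by
        gcongr
        exact hconc u u' hlen (by omega)
      have h2 := mul_le_mul_of_nonneg_left (hpost u u' hlen (by omega)) hZ
      -- `η / (1 - δ)` is the fixed point of `v ↦ δ v + η`, so the induction reproduces its own
      -- bound.
      have h3 : E.δ * (η / (1 - E.δ)) + η = η / (1 - E.δ) := by field_simp; ring
      have h4 : E.δ * (E.δ ^ m * (2 * B)) = E.δ ^ (m + 1) * (2 * B) := by ring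
      rw [mul_add, h4]
      linarith
    rw [hW (h₀ ++ u), hW (h₀ ++ u')]
    exact (abs_max_sub_max_le_max _ _ _ _).trans (max_le (hstep _) (hstep _))

/-- If innovation is optimal, the posterior mean of the robustness thresholds relative to the
concern is at least one, up to the effect of the action on continuation values. -/
theorem cost_le_of_innovate_optimal {h : PrivateHistory} (hpos : 0 < E.concern h) {ε : ℝ}
    (hcont : ∀ y, |W (h ++ [(.innovate, y)]) - W (h ++ [(.safe, y)])| ≤ ε)
    (hopt : E.actionValue x W h .safe ≤ E.actionValue x W h .innovate) :
    E.k ≤ E.k * (∑ j, E.posterior h j * E.lambdaBar j) / E.concern h + ε := by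
  simp only [actionValue, cost] at hopt
  set z : Action → Outcome → ℝ := fun a y => x (publicPart h) y + E.δ * W (h ++ [(a, y)])
  have hε := (abs_nonneg _).trans (hcont true)
  have h1 : ∀ j, robustValue (bern (E.model j .innovate)) (z .innovate) (E.concern h) -
      robustValue (bern (E.model j .safe)) (z .safe) (E.concern h) ≤
      E.k * E.lambdaBar j / E.concern h + ε := by
    intro j
    have hz : ∀ y, |z .innovate y - z .safe y| ≤ ε := fun y => by
      simp only [z, add_sub_add_left_eq_sub, ← mul_sub, abs_mul, abs_of_pos E.δ_pos]
      exact (mul_le_of_le_one_left (abs_nonneg _) E.δ_lt_one.le).trans (hcont y)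
    have h2 := E.robustValue_innovate_sub_safe_le j (z .innovate) hpos
    have h3 := (abs_le.mp (abs_robustValue_sub_le (E.model_pos j .safe) (E.model_lt_one j .safe)
      hpos hz)).2
    linarith
  have h2 : E.aggregator .innovate (z .innovate) (E.posterior h) (E.concern h) -
      E.aggregator .safe (z .safe) (E.posterior h) (E.concern h) ≤
      ∑ j, E.posterior h j * (E.k * E.lambdaBar j / E.concern h + ε) := by
    simp only [aggregator, ← Finset.sum_sub_distrib, ← mul_sub]
    exact Finset.sum_le_sum fun j _ =>
      mul_le_mul_of_nonneg_left (h1 j) (E.posterior_nonneg h j)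
  have h3 : ∑ j, E.posterior h j * (E.k * E.lambdaBar j / E.concern h + ε) =
      E.k * (∑ j, E.posterior h j * E.lambdaBar j) / E.concern h + ε := by
    simp only [mul_add, Finset.sum_add_distrib, ← Finset.sum_mul, E.sum_posterior, one_mul,
      Finset.mul_sum, Finset.sum_div]
    congr 1
    exact Finset.sum_congr rfl fun j _ => by ring
  linarith

end Env

/-! ### Stability of the agent's state under appended observations. -/

theorem likelihood_append (r : Action → ℝ) (h u : PrivateHistory) :
    likelihood r (h ++ u) = likelihood r h * likelihood r u := by
  simp [likelihood]

theorem bern_mem_Icc {θ : ℝ} (hθ : θ ∈ Set.Icc (0 : ℝ) 1) (y : Outcome) :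
    bern θ y ∈ Set.Icc (0 : ℝ) 1 := by
  obtain ⟨h0, h1⟩ := hθ
  cases y <;> constructor <;> simp only [bern] <;> linarith

theorem likelihood_nonneg {r : Action → ℝ} (hr : ∀ a, r a ∈ Set.Icc (0 : ℝ) 1)
    (h : PrivateHistory) : 0 ≤ likelihood r h :=
  List.prod_nonneg fun _ hb => by
    obtain ⟨ay, -, rfl⟩ := List.mem_map.mp hb
    exact (bern_mem_Icc (hr _) _).1

theorem pow_length_le_likelihood {r : Action → ℝ} {c : ℝ} (hc : 0 ≤ c)
    (hr : ∀ a y, c ≤ bern (r a) y) (h : PrivateHistory) : c ^ h.length ≤ likelihood r h := by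
  induction h with
  | nil => simp [likelihood]
  | cons ay h ih =>
    rw [List.length_cons, pow_succ']
    exact mul_le_mul (hr ay.1 ay.2) ih (by positivity) (hc.trans (hr _ _))

theorem pow_length_mul_likelihood_le {r r' : Action → ℝ} {c : ℝ} (hc : 0 ≤ c)
    (hr : ∀ a, r a ∈ Set.Icc (0 : ℝ) 1) (hrr : ∀ a y, c * bern (r a) y ≤ bern (r' a) y)
    (h : PrivateHistory) : c ^ h.length * likelihood r h ≤ likelihood r' h := by
  induction h with
  | nil => simp [likelihood]
  | cons ay h ih =>
    have h1 : likelihood r (ay :: h) = bern (r ay.1) ay.2 * likelihood r h := rfl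
    have h2 : likelihood r' (ay :: h) = bern (r' ay.1) ay.2 * likelihood r' h := rfl
    rw [h1, h2, List.length_cons, pow_succ', mul_mul_mul_comm]
    exact mul_le_mul (hrr ay.1 ay.2) ih
      (mul_nonneg (by positivity) (likelihood_nonneg hr h))
      ((mul_nonneg hc (bern_mem_Icc (hr _) _).1).trans (hrr _ _))

instance : Nonempty Action := ⟨.safe⟩

/-- The maximal likelihood over unstructured models. -/
def unstructuredLikelihood (h : PrivateHistory) : ℝ :=
  ⨆ r : Action → Set.Icc (0 : ℝ) 1, likelihood (fun a => (r a : ℝ)) h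

theorem likelihood_le_unstructured {r : Action → ℝ} (hr : ∀ a, r a ∈ Set.Icc (0 : ℝ) 1)
    (h : PrivateHistory) : likelihood r h ≤ unstructuredLikelihood h :=
  le_ciSup (f := fun r : Action → Set.Icc (0 : ℝ) 1 => likelihood (fun a => (r a : ℝ)) h)
    ⟨1, by rintro _ ⟨r, rfl⟩; exact Env.likelihood_le_one (fun a => (r a).2) h⟩
    (fun a => ⟨r a, hr a⟩)

instance : Nonempty (Set.Icc (0 : ℝ) 1) := ⟨⟨0, by simp⟩⟩

theorem unstructuredLikelihood_append_le (h u : PrivateHistory) :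
    unstructuredLikelihood (h ++ u) ≤ unstructuredLikelihood h := by
  refine ciSup_le fun r => ?_
  rw [likelihood_append]
  exact (mul_le_of_le_one_right (likelihood_nonneg (fun a => (r a).2) h)
    (Env.likelihood_le_one (fun a => (r a).2) u)).trans
      (likelihood_le_unstructured (fun a => (r a).2) h)

/-- Appending observations lowers the maximal likelihood by at most a polynomial factor: mix the
maximizer with the uniform distribution. -/
theorem le_unstructuredLikelihood_append (h u : PrivateHistory) :
    1 / 2 * (1 / (4 * ((h.length : ℝ) + 1))) ^ u.length * unstructuredLikelihood h ≤
      unstructuredLikelihood (h ++ u) := by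
  set ε : ℝ := 1 / (2 * ((h.length : ℝ) + 1)) with hε
  have hε0 : 0 < ε := by positivity
  have hε1 : ε ≤ 1 := by
    rw [hε, div_le_one (by positivity)]
    linarith [h.length.cast_nonneg (α := ℝ)]
  have hhalf : 1 / (4 * ((h.length : ℝ) + 1)) = ε / 2 := by rw [hε]; field_simp; norm_num
  -- Bernoulli's inequality: a mixing weight of order `1 / length` loses only a constant factor on
  -- the old data, while giving every new outcome probability at least `ε / 2`.
  have hpow : 1 / 2 ≤ (1 - ε) ^ h.length := by
    have := one_add_mul_le_pow (a := -ε) (by linarith) h.length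
    rw [← sub_eq_add_neg] at this
    refine le_trans ?_ this
    have : (h.length : ℝ) * ε ≤ 1 / 2 := by
      rw [hε, mul_one_div, div_le_div_iff₀ (by positivity) (by positivity)]
      linarith
    linarith
  rw [hhalf]
  have hfac : 0 < 1 / 2 * (ε / 2) ^ u.length := by positivity
  rw [← le_div_iff₀' hfac]
  refine ciSup_le fun r => ?_
  rw [le_div_iff₀' hfac]
  set r' : Action → ℝ := fun a => (1 - ε) * r a + ε / 2 with hr'
  have hmem : ∀ a, r' a ∈ Set.Icc (0 : ℝ) 1 := fun a => by
    obtain ⟨h0, h1⟩ := (r a).2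
    have : 0 ≤ 1 - ε := by linarith
    refine ⟨by simp only [hr']; positivity, ?_⟩
    simp only [hr']
    nlinarith
  have hmix : ∀ a y, bern (r' a) y = (1 - ε) * bern (r a) y + ε / 2 := fun a y => by
    cases y <;> simp only [bern, hr']
    ring
  have hb : ∀ a y, 0 ≤ bern (r a : ℝ) y := fun a y => (bern_mem_Icc (r a).2 y).1
  have hA := pow_length_mul_likelihood_le (r := fun a => (r a : ℝ)) (r' := r') (c := 1 - ε)
    (by linarith) (fun a => (r a).2) (fun a y => by rw [hmix]; linarith) h
  have hB := pow_length_le_likelihood (r := r') (c := ε / 2) (by positivity)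
    (fun a y => by
      rw [hmix]
      linarith [mul_nonneg (show 0 ≤ 1 - ε by linarith) (hb a y)]) u
  have hL := likelihood_nonneg (fun a => (r a).2) h
  refine le_trans ?_ (likelihood_le_unstructured hmem (h ++ u))
  rw [likelihood_append]
  calc 1 / 2 * (ε / 2) ^ u.length * likelihood (fun a => (r a : ℝ)) h
      = (1 / 2 * likelihood (fun a => (r a : ℝ)) h) * (ε / 2) ^ u.length := by ring
    _ ≤ likelihood r' h * likelihood r' u :=
        mul_le_mul ((mul_le_mul_of_nonneg_right hpow hL).trans hA) hB (by positivity)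
          (likelihood_nonneg hmem h)

/-- The other structured model. -/
def Model.other : Model → Model
  | .low => .high
  | .high => .low

theorem Model.other_ne (q : Model) : q.other ≠ q := by
  cases q <;> simp [Model.other]

theorem sum_model (q : Model) (f : Model → ℝ) : ∑ j, f j = f q + f q.other := by
  have h : ∑ j, f j = f .low + f .high := by
    change ∑ j ∈ {Model.low, Model.high}, f j = _
    rw [Finset.sum_pair (by simp)]
  cases q
  · exact h
  · rw [h, add_comm]; rfl

namespace Env

variable (E : Env)

theorem model_mem_Icc (j : Model) (a : Action) : E.model j a ∈ Set.Icc (0 : ℝ) 1 :=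
  ⟨(E.model_pos j a).le, (E.model_lt_one j a).le⟩

theorem exists_minProb : ∃ β : ℝ, 0 < β ∧ β ≤ 1 ∧ ∀ j a y, β ≤ bern (E.model j a) y := by
  obtain ⟨⟨j, a, y⟩, h⟩ := Finite.exists_min
    fun i : Model × Action × Outcome => bern (E.model i.1 i.2.1) i.2.2
  refine ⟨_, ?_, (bern_mem_Icc (E.model_mem_Icc j a) y).2, fun j a y => h (j, a, y)⟩
  cases y
  exacts [sub_pos.mpr (E.model_lt_one j a), E.model_pos j a]

theorem unstructuredLikelihood_pos (E : Env) (h : PrivateHistory) : 0 < unstructuredLikelihood h :=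
  (E.likelihood_empiricalModel_pos h).trans_le
    (likelihood_le_unstructured (E.empiricalModel_mem_Icc h) h)

/-- Bound on the change of the log-likelihood ratio when at most `n` observations are appended. -/
def drift (β : ℝ) (n t : ℕ) : ℝ :=
  Real.log 2 + n * (Real.log (4 * ((t : ℝ) + 1)) + Real.log (1 / β))

theorem tendsto_drift (β : ℝ) (n : ℕ) :
    Tendsto (fun t : ℕ => drift β n t / ((t : ℝ) + 1)) atTop (𝓝 0) := by
  have hT : Tendsto (fun t : ℕ => (t : ℝ) + 1) atTop atTop :=
    tendsto_atTop_add_const_right _ _ tendsto_natCast_atTop_atTop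
  have hlog : Tendsto (fun t : ℕ => Real.log ((t : ℝ) + 1) / ((t : ℝ) + 1)) atTop (𝓝 0) :=
    (Real.isLittleO_log_id_atTop.tendsto_div_nhds_zero).comp hT
  have hinv : Tendsto (fun t : ℕ => ((t : ℝ) + 1)⁻¹) atTop (𝓝 0) := tendsto_inv_atTop_zero.comp hT
  have h := (hinv.const_mul (Real.log 2 + n * (Real.log 4 + Real.log (1 / β)))).add
    (hlog.const_mul (n : ℝ))
  simp only [mul_zero, add_zero] at h
  refine h.congr fun t => ?_
  rw [drift, Real.log_mul (by norm_num) (by positivity)]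
  field_simp
  ring

variable {E}

/-- Structured likelihoods lose at most a factor `β` per observation. The unstructured maximum may
sit on the boundary, so its loss is controlled only polynomially in `t`; this is the source of the
logarithm in `drift`. -/
theorem abs_LLR_append_sub_le {β : ℝ} (hβ : 0 < β) (hβ1 : β ≤ 1)
    (hβE : ∀ j a y, β ≤ bern (E.model j a) y) (h u : PrivateHistory) {n : ℕ} (hu : u.length ≤ n) :
    |E.LLR (h ++ u) - E.LLR h| ≤ drift β n h.length := by
  have hA := E.unstructuredLikelihood_pos h
  have hA' := E.unstructuredLikelihood_pos (h ++ u)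
  have hLLR : ∀ h', ∃ M, 0 < M ∧ (∀ j, likelihood (E.model j) h' ≤ M) ∧
      (∃ j, likelihood (E.model j) h' = M) ∧
      E.LLR h' = Real.log (unstructuredLikelihood h') - Real.log M := fun h' => by
    obtain ⟨j, hj⟩ := exists_eq_ciSup_of_finite (f := fun j => likelihood (E.model j) h')
    have hM : 0 < ⨆ j, likelihood (E.model j) h' := hj ▸ E.likelihood_model_pos j h'
    refine ⟨_, hM, fun i => Finite.le_ciSup (fun j => likelihood (E.model j) h') i, ⟨j, hj⟩, ?_⟩
    rw [LLR, ← unstructuredLikelihood, Real.log_div hM.ne' (E.unstructuredLikelihood_pos h').ne',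
      neg_sub]
  obtain ⟨M, hM, hMle, ⟨j, hj⟩, hL⟩ := hLLR h
  obtain ⟨M', hM', hMle', ⟨j', hj'⟩, hL'⟩ := hLLR (h ++ u)
  have hMM : M' ≤ M := by
    rw [← hj', likelihood_append]
    exact (mul_le_of_le_one_right (E.likelihood_model_pos j' h).le
      (likelihood_le_one (E.model_mem_Icc j') u)).trans (hMle j')
  have hMM' : M * β ^ u.length ≤ M' := by
    refine le_trans ?_ (hMle' j)
    rw [likelihood_append, hj]
    exact mul_le_mul_of_nonneg_left (pow_length_le_likelihood hβ.le (hβE j) u) hM.le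
  have l1 := Real.log_le_log hM' hMM
  have l2 := Real.log_le_log (by positivity) hMM'
  have l3 := Real.log_le_log hA' (unstructuredLikelihood_append_le h u)
  have l4 := Real.log_le_log (by positivity) (le_unstructuredLikelihood_append h u)
  rw [Real.log_mul hM.ne' (by positivity), Real.log_pow] at l2
  rw [Real.log_mul (by positivity) hA.ne', Real.log_mul (by norm_num) (by positivity), Real.log_pow,
    one_div, Real.log_inv, one_div, Real.log_inv] at l4
  have hb : 0 ≤ Real.log (1 / β) := Real.log_nonneg ((one_le_div hβ).mpr hβ1)
  have h4 : 0 ≤ Real.log (4 * ((h.length : ℝ) + 1)) :=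
    Real.log_nonneg (by linarith [h.length.cast_nonneg (α := ℝ)])
  have h2 : 0 ≤ Real.log 2 := Real.log_nonneg (by norm_num)
  have hun : (u.length : ℝ) ≤ n := by exact_mod_cast hu
  have hnb : Real.log (1 / β) = -Real.log β := by rw [one_div, Real.log_inv]
  have m1 := mul_le_mul_of_nonneg_right hun hb
  have m2 := mul_le_mul_of_nonneg_right hun h4
  have m3 : (0 : ℝ) ≤ u.length * Real.log (1 / β) := by positivity
  have m4 : (0 : ℝ) ≤ u.length * Real.log (4 * ((h.length : ℝ) + 1)) := by positivity
  rw [hnb] at m1 m3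
  rw [hL, hL', abs_le, drift, hnb]
  constructor <;> linarith

theorem abs_concern_append_sub_le {β : ℝ} (hβ : 0 < β) (hβ1 : β ≤ 1)
    (hβE : ∀ j a y, β ≤ bern (E.model j a) y) (h u u' : PrivateHistory) {n : ℕ}
    (hlen : u.length = u'.length) (hu : u.length ≤ n) :
    |E.concern (h ++ u) - E.concern (h ++ u')| ≤
      2 / E.γ * (drift β n h.length / ((h.length : ℝ) + 1)) := by
  have hγ := E.γ_pos
  have h1 := abs_LLR_append_sub_le hβ hβ1 hβE h u hu
  have h2 := abs_LLR_append_sub_le hβ hβ1 hβE h u' (hlen ▸ hu)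
  have h3 : |E.LLR (h ++ u) - E.LLR (h ++ u')| ≤ 2 * drift β n h.length := by
    rw [abs_sub_comm] at h2
    linarith [abs_sub_le (E.LLR (h ++ u)) (E.LLR h) (E.LLR (h ++ u'))]
  simp only [concern, List.length_append, ← hlen, Nat.cast_add, ← sub_div]
  rw [abs_div, abs_of_pos (by positivity : 0 < E.γ * ((h.length : ℝ) + u.length + 1)),
    div_mul_div_comm]
  exact div_le_div₀ ((abs_nonneg _).trans h3) h3 (by positivity)
    (mul_le_mul_of_nonneg_left (by linarith [u.length.cast_nonneg (α := ℝ)]) hγ.le)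

/-- The numerator keeps at least `3/4` of the lower bound `c * γ * (t + 1)`, where `t` is the length
of `h`, and the denominator grows by a factor of at most `3/2`, which gives `c / 2`. -/
theorem half_le_concern_append {β : ℝ} (hβ : 0 < β) (hβ1 : β ≤ 1)
    (hβE : ∀ j a y, β ≤ bern (E.model j a) y) (h u : PrivateHistory) {n : ℕ} {c : ℝ} (hc : 0 < c)
    (hu : u.length ≤ n) (hcon : c ≤ E.concern h) (hn : 2 * (n : ℝ) ≤ (h.length : ℝ) + 1)
    (hdrift : drift β n h.length / ((h.length : ℝ) + 1) ≤ c * E.γ / 4) :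
    c / 2 ≤ E.concern (h ++ u) := by
  have hγ := E.γ_pos
  have h1 := (abs_le.mp (abs_LLR_append_sub_le hβ hβ1 hβE h u hu)).1
  have hun : (u.length : ℝ) ≤ n := by exact_mod_cast hu
  rw [concern, le_div_iff₀ (by positivity)] at hcon
  rw [div_le_iff₀ (by positivity)] at hdrift
  rw [concern, le_div_iff₀ (by positivity), List.length_append, Nat.cast_add]
  have h2 : c * E.γ * (u.length : ℝ) ≤ c * E.γ * (((h.length : ℝ) + 1) / 2) := by
    gcongr
    linarith
  nlinarith

theorem odds_append_le {β : ℝ} (hβ : 0 < β) (hβ1 : β ≤ 1)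
    (hβE : ∀ j a y, β ≤ bern (E.model j a) y) (i j : Model) (h u : PrivateHistory) {n : ℕ}
    (hu : u.length ≤ n) : E.odds i j (h ++ u) ≤ E.odds i j h / β ^ n := by
  have hi := E.prior_pos i
  have hj := E.prior_pos j
  have hLi := E.likelihood_model_pos i h
  have hLj := E.likelihood_model_pos j h
  rw [odds, odds, div_div, likelihood_append, likelihood_append, ← mul_assoc, ← mul_assoc]
  refine div_le_div₀ (by positivity) (mul_le_of_le_one_right (by positivity)
    (likelihood_le_one (E.model_mem_Icc i) u)) (by positivity) ?_
  refine mul_le_mul_of_nonneg_left ?_ (by positivity)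
  exact (pow_le_pow_of_le_one hβ.le hβ1 hu).trans (pow_length_le_likelihood hβ.le (hβE j) u)

theorem sum_abs_posterior_sub_le (q : Model) {h h' : PrivateHistory} {κ : ℝ}
    (hκ : E.odds q.other q h ≤ κ) (hκ' : E.odds q.other q h' ≤ κ) :
    ∑ j, |E.posterior h j - E.posterior h' j| ≤ 2 * κ := by
  have h1 := E.sum_posterior h
  have h2 := E.sum_posterior h'
  rw [sum_model q] at h1 h2 ⊢
  have h3 := (E.posterior_le_odds h q.other q).trans hκ
  have h4 := (E.posterior_le_odds h' q.other q).trans hκ'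
  have h5 := E.posterior_nonneg h q.other
  have h6 := E.posterior_nonneg h' q.other
  have h7 : E.posterior h q - E.posterior h' q =
      -(E.posterior h q.other - E.posterior h' q.other) := by linarith
  have h8 : |E.posterior h q.other - E.posterior h' q.other| ≤ κ :=
    abs_le.mpr ⟨by linarith, by linarith⟩
  rw [h7, abs_neg]
  linarith

theorem sum_posterior_mul_lambdaBar_le (q : Model) (h : PrivateHistory) :
    ∑ j, E.posterior h j * E.lambdaBar j ≤
      E.lambdaBar q + E.odds q.other q h * E.lambdaBar q.other := by
  have h1 := E.sum_posterior h
  rw [sum_model q] at h1 ⊢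
  have h2 := E.posterior_nonneg h q.other
  have h3 := E.posterior_le_odds h q.other q
  exact add_le_add (mul_le_of_le_one_left (E.lambdaBar_pos q).le (by linarith))
    (mul_le_mul_of_nonneg_right h3 (E.lambdaBar_pos _).le)

/-! ### Optimal innovation bounds the concern. -/

/-- Along histories on which the posterior concentrates on `q`, innovation is eventually optimal only
if the concern does not exceed the robustness threshold of `q` by more than `ε`. -/
theorem eventually_concern_le {x : Contract} {W : PrivateHistory → ℝ} (hx : x.IsBounded)
    (hW : E.IsContinuationValue x W) {H : ℕ → PrivateHistory} (hlen : ∀ t, (H t).length = t)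
    {q : Model} (hodds : Tendsto (fun t => E.odds q.other q (H t)) atTop (𝓝 0))
    {ε : ℝ} (hε : 0 < ε) :
    ∀ᶠ t in atTop, E.actionValue x W (H t) .safe ≤ E.actionValue x W (H t) .innovate →
      E.concern (H t) ≤ E.lambdaBar q + ε := by
  obtain ⟨Bx, hBx⟩ := hx
  obtain ⟨⟨B, hB⟩, hrec⟩ := hW
  obtain ⟨β, hβ, hβ1, hβE⟩ := E.exists_minProb
  have hk := E.k_pos
  have hγ := E.γ_pos
  have hq := E.lambdaBar_pos q
  set c := E.lambdaBar q + ε with hc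
  have hc0 : 0 < c := by positivity
  -- The part of the cost left uncovered by the largest robust gain at concern `c`. Discounting and
  -- the vanishing errors each receive half of it.
  set gap := E.k * (1 - E.lambdaBar q / c) with hgap
  have hgap0 : 0 < gap := by
    refine mul_pos hk (sub_pos.mpr ((div_lt_one hc0).mpr ?_))
    linarith
  obtain ⟨m, hm⟩ : ∃ m : ℕ, E.δ ^ m * (2 * B) < gap / 2 := by
    have h := (tendsto_pow_atTop_nhds_zero_of_lt_one E.δ_pos.le E.δ_lt_one).mul_const (2 * B)
    rw [zero_mul] at h
    exact (h.eventually_lt_const (half_pos hgap0)).exists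
  -- The histories compared already carry one appended observation, followed by `m` steps of the
  -- recursion.
  set n := m + 1 with hn
  have hdrift := tendsto_drift β n
  have herr : Tendsto (fun t : ℕ =>
      (2 * (Bx + B) * (2 / E.γ * (drift β n t / ((t : ℝ) + 1))) / (c / 2) +
        (Bx + B) * (2 * (E.odds q.other q (H t) / β ^ n))) / (1 - E.δ) +
      E.k * (E.odds q.other q (H t) * E.lambdaBar q.other) / c) atTop (𝓝 0) := by
    have := ((((hdrift.const_mul (2 / E.γ)).const_mul (2 * (Bx + B))).div_const (c / 2)).add
      (((hodds.div_const (β ^ n)).const_mul 2).const_mul (Bx + B))).div_const (1 - E.δ) |>.add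
      (((hodds.mul_const (E.lambdaBar q.other)).const_mul E.k).div_const c)
    simpa using this
  filter_upwards [herr.eventually_lt_const (half_pos hgap0),
    hdrift.eventually_le_const (show 0 < c * E.γ / 4 by positivity),
    eventually_ge_atTop (2 * n)] with t herr hdt hnt hopt
  -- The contradiction hypothesis also supplies the lower bound on the concern needed for the
  -- Lipschitz estimates over the next `n` periods.
  by_contra! hcon
  have hnt' : 2 * (n : ℝ) ≤ (t : ℝ) + 1 := by
    have : ((2 * n : ℕ) : ℝ) ≤ t := by exact_mod_cast hnt
    push_cast at this
    linarith
  have hclose := abs_continuationValue_sub_le (E := E) hBx hB hrec (H t) (n := n) (half_pos hc0)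
    (fun u hu => half_le_concern_append hβ hβ1 hβE (H t) u hc0 hu hcon.le
      (by rwa [hlen]) (by rwa [hlen]))
    (fun u u' huu hu => abs_concern_append_sub_le hβ hβ1 hβE (H t) u u' huu hu)
    (fun u u' huu hu => sum_abs_posterior_sub_le q
      (odds_append_le hβ hβ1 hβE q.other q (H t) u hu)
      (odds_append_le hβ hβ1 hβE q.other q (H t) u' (huu ▸ hu))) m
  have hpos := hc0.trans hcon
  have hcost := cost_le_of_innovate_optimal hpos
    (fun y => hclose [(.innovate, y)] [(.safe, y)] rfl rfl (by simp [hn, add_comm])) hopt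
  rw [hlen] at hcost
  have hmean : E.k * (∑ j, E.posterior (H t) j * E.lambdaBar j) / E.concern (H t) ≤
      E.k * (E.lambdaBar q + E.odds q.other q (H t) * E.lambdaBar q.other) / c := by
    have h0 : 0 ≤ E.odds q.other q (H t) :=
      (E.posterior_nonneg _ _).trans (E.posterior_le_odds _ _ _)
    have h1 := E.lambdaBar_pos q.other
    have h2 := sum_posterior_mul_lambdaBar_le (E := E) q (H t)
    gcongr
  have hsplit : E.k * (E.lambdaBar q + E.odds q.other q (H t) * E.lambdaBar q.other) / c =
      E.k - gap + E.k * (E.odds q.other q (H t) * E.lambdaBar q.other) / c := by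
    rw [hgap]
    ring
  linarith

/-! ### The speed limit -/

theorem Dstar_le (j : Model) : E.Dstar ≤ E.divergence j :=
  Finset.inf'_le _ (Finset.mem_univ j)

theorem divergence_lt_other {q : Model} (hq : E.bestFit = {q}) :
    E.divergence q < E.divergence q.other := by
  have h1 : q ∈ E.bestFit := by simp [hq]
  have h2 : q.other ∉ E.bestFit := by simp [hq, Model.other_ne]
  simp only [bestFit, Finset.mem_filter, Finset.mem_univ, true_and] at h1 h2
  refine lt_of_le_of_ne (h1 _) fun heq => h2 fun i => ?_
  rw [← heq]
  exact h1 i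

theorem alphaStar_eq {q : Model} (hq : E.bestFit = {q}) :
    E.alphaStar = E.γ / E.Dstar * E.lambdaBar q := by
  simp only [alphaStar, hq, Finset.sup'_singleton]

/-- Once the success rate has converged, innovation is optimal only if the number of past trials is
below any rate exceeding the speed limit. -/
theorem eventually_trials_le {x : Contract} {W : PrivateHistory → ℝ} (hx : x.IsBounded)
    (hW : E.IsContinuationValue x W) {H : ℕ → PrivateHistory} (hlen : ∀ t, (H t).length = t)
    (htrials : Tendsto (fun t => trials (H t)) atTop atTop)
    (hrate : Tendsto (fun t => successRate (H t)) atTop (𝓝 (E.pstar .innovate)))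
    (hmis : 0 < E.Dstar) {q : Model} (hq : E.bestFit = {q}) {c : ℝ} (hc : E.alphaStar < c) :
    ∀ᶠ t in atTop, E.actionValue x W (H t) .safe ≤ E.actionValue x W (H t) .innovate →
      (trials (H t) : ℝ) ≤ c * ((t : ℝ) + 1) := by
  have hγ := E.γ_pos
  have hkl : ∀ j, Tendsto (fun t => klDivergence (bern (successRate (H t))) (bern (E.theta j)))
      atTop (𝓝 (E.divergence j)) := fun j =>
    ((continuous_klDivergence_bern (E.theta_pos j) (E.theta_lt_one j)).tendsto _).comp hrate
  have htrials' : Tendsto (fun t => (trials (H t) : ℝ)) atTop atTop :=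
    tendsto_natCast_atTop_atTop.comp htrials
  have hodds : Tendsto (fun t => E.odds q.other q (H t)) atTop (𝓝 0) := by
    simp only [odds_eq]
    have h1 := htrials'.atTop_mul_neg (sub_neg.mpr (divergence_lt_other hq))
      ((hkl q).sub (hkl q.other))
    simpa using (Real.tendsto_exp_atBot.comp h1).const_mul (E.prior q.other / E.prior q)
  rw [alphaStar_eq hq] at hc
  -- At `ε = 0` the expression is `α*`, so continuity leaves room for errors in both the concern
  -- threshold and the divergence.
  obtain ⟨ε, hε, hεD, hεc⟩ : ∃ ε : ℝ, 0 < ε ∧ ε < E.Dstar ∧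
      E.γ / (E.Dstar - ε) * (E.lambdaBar q + ε) < c := by
    have hcont : ContinuousAt (fun ε : ℝ => E.γ / (E.Dstar - ε) * (E.lambdaBar q + ε)) 0 := by
      have : E.Dstar - 0 ≠ 0 := by simpa using hmis.ne'
      fun_prop (disch := assumption)
    have h1 : ∀ᶠ ε : ℝ in 𝓝[>] 0, E.γ / (E.Dstar - ε) * (E.lambdaBar q + ε) < c :=
      (hcont.tendsto.eventually_lt_const (by simpa using hc)).filter_mono nhdsWithin_le_nhds
    have h2 : ∀ᶠ ε : ℝ in 𝓝[>] 0, ε < E.Dstar :=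
      (eventually_lt_nhds hmis).filter_mono nhdsWithin_le_nhds
    obtain ⟨ε, h1, h2, h3⟩ := (h1.and (h2.and self_mem_nhdsWithin)).exists
    exact ⟨ε, h3, h2, h1⟩
  -- Uniformity in `j` is needed because the model provided by `exists_le_LLR` may vary with `t`;
  -- `D*` bounds both divergences from below.
  have hklε : ∀ᶠ t in atTop, ∀ j,
      E.Dstar - ε ≤ klDivergence (bern (successRate (H t))) (bern (E.theta j)) :=
    eventually_all.mpr fun j => (hkl j).eventually_const_le (by linarith [E.Dstar_le j])
  filter_upwards [eventually_concern_le hx hW hlen hodds hε, hklε] with t hcon hkl hopt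
  obtain ⟨j, hj⟩ := E.exists_le_LLR (H t)
  have h1 := hcon hopt
  rw [concern, hlen, div_le_iff₀ (by positivity)] at h1
  have hD : 0 < E.Dstar - ε := by linarith
  have h2 : (trials (H t) : ℝ) * (E.Dstar - ε) ≤
      (E.lambdaBar q + ε) * (E.γ * ((t : ℝ) + 1)) :=
    (mul_le_mul_of_nonneg_left (hkl j) (Nat.cast_nonneg _)).trans (hj.trans h1)
  calc (trials (H t) : ℝ) ≤ (E.lambdaBar q + ε) * (E.γ * ((t : ℝ) + 1)) / (E.Dstar - ε) :=
        (le_div_iff₀ hD).mpr h2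
    _ = E.γ / (E.Dstar - ε) * (E.lambdaBar q + ε) * ((t : ℝ) + 1) := by ring
    _ ≤ c * ((t : ℝ) + 1) := by gcongr

theorem alphaStar_nonneg (hmis : 0 < E.Dstar) : 0 ≤ E.alphaStar := by
  obtain ⟨q, hq⟩ := E.bestFit_nonempty
  exact mul_nonneg (div_pos E.γ_pos hmis).le
    ((E.lambdaBar_pos q).le.trans (Finset.le_sup' E.lambdaBar hq))

end Env

/-! ### From trial counts to long-run shares. -/

/-- If trials occur only while their number is at most `c (t + 1)`, it is at most `c T` up to a
constant. -/
theorem exists_trials_le (a : ℕ → Action) (y : ℕ → Outcome) {c : ℝ} (hc : 0 ≤ c)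
    (h : ∀ᶠ t in atTop, a t = .innovate →
      (trials (pathHistory a y t) : ℝ) ≤ c * ((t : ℝ) + 1)) :
    ∃ C : ℝ, ∀ᶠ T : ℕ in atTop, (trials (pathHistory a y T) : ℝ) ≤ c * T + C := by
  obtain ⟨t₀, ht₀⟩ := eventually_atTop.mp h
  -- The first term covers the initial segment, and the `1` covers a trial made right at the line.
  refine ⟨trials (pathHistory a y t₀) + 1, eventually_atTop.mpr ⟨t₀, fun T hT => ?_⟩⟩
  induction T, hT using Nat.le_induction with
  | base => nlinarith [t₀.cast_nonneg (α := ℝ)]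
  | succ T hT ih =>
    have h0 : (0 : ℝ) ≤ trials (pathHistory a y t₀) := Nat.cast_nonneg _
    rw [trials_pathHistory_succ]
    push_cast
    split_ifs with ha
    · linarith [ht₀ T hT ha]
    · linarith

theorem innovationShare_eq (a : ℕ → Action) (y : ℕ → Outcome) (T : ℕ) :
    innovationShare a T = trials (pathHistory a y T) / T := by
  rw [innovationShare, trials_pathHistory_eq_sum]

theorem limsup_innovationShare_le (a : ℕ → Action) (y : ℕ → Outcome) {c C : ℝ}
    (h : ∀ᶠ T : ℕ in atTop, (trials (pathHistory a y T) : ℝ) ≤ c * T + C) :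
    limsup (fun T => innovationShare a T) atTop ≤ c := by
  have hle : ∀ᶠ T : ℕ in atTop, innovationShare a T ≤ c + C / T := by
    filter_upwards [h, eventually_gt_atTop 0] with T hT hT0
    have hT0' : (0 : ℝ) < T := by exact_mod_cast hT0
    rw [innovationShare_eq a y, div_le_iff₀ hT0', add_mul, div_mul_cancel₀ _ hT0'.ne']
    exact hT
  have hlim : Tendsto (fun T : ℕ => c + C / (T : ℝ)) atTop (𝓝 c) := by
    simpa using (tendsto_const_div_atTop_nhds_zero_nat C).const_add c
  refine (limsup_le_limsup hle ?_ hlim.isBoundedUnder_le).trans hlim.limsup_eq.le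
  refine IsBoundedUnder.isCoboundedUnder_le ⟨0, eventually_map.mpr (Eventually.of_forall fun T => ?_)⟩
  rw [innovationShare_eq a y]
  exact div_nonneg (Nat.cast_nonneg _) (Nat.cast_nonneg _)

theorem frequently_safe (a : ℕ → Action) (y : ℕ → Outcome) {c C : ℝ} (hc : c < 1)
    (h : ∀ᶠ T : ℕ in atTop, (trials (pathHistory a y T) : ℝ) ≤ c * T + C) :
    ∃ᶠ t in atTop, a t = .safe := by
  intro hev
  obtain ⟨t₀, ht₀⟩ := eventually_atTop.mp hev
  -- If the safe action stopped after `t₀`, trials would grow at slope one, exceeding every line of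
  -- slope `c < 1`.
  have hlow : ∀ T ≥ t₀, (T : ℝ) - t₀ ≤ trials (pathHistory a y T) := by
    intro T hT
    induction T, hT using Nat.le_induction with
    | base => simp
    | succ T hT ih =>
      have ha : a T = .innovate := by
        cases h : a T
        exacts [absurd h (ht₀ T hT), rfl]
      rw [trials_pathHistory_succ, if_pos ha]
      push_cast
      linarith
  have hbig : ∀ᶠ T : ℕ in atTop, (C + t₀) / (1 - c) < T :=
    tendsto_natCast_atTop_atTop.eventually_gt_atTop _
  obtain ⟨T, h1, h2, h3⟩ := (h.and (hbig.and (eventually_ge_atTop t₀))).exists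
  rw [div_lt_iff₀ (by linarith)] at h2
  linarith [hlow T h3]

end InnovationCycles

end

theorem theorem2 {Ω : Type*} {mΩ : MeasurableSpace Ω} (P : Measure Ω) [IsProbabilityMeasure P]
    (E : InnovationCycles.Env)
    -- the roadmap is misspecified, with a unique best-fit model
    (hmis : 0 < E.Dstar) (huniq : ∃ q : InnovationCycles.Model, E.bestFit = {q})
    -- a bounded contract, and an equilibrium path under it
    (x : InnovationCycles.Contract) (hx : x.IsBounded)
    (ℱ : Filtration ℕ mΩ) (a : ℕ → Ω → InnovationCycles.Action)
    (y : ℕ → Ω → InnovationCycles.Outcome)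
    (hdata : InnovationCycles.IsDataGenerating E P ℱ a y)
    (W : InnovationCycles.PrivateHistory → ℝ)
    (heq : InnovationCycles.IsEquilibriumPath E P x W a y) :
    ∀ᵐ ω ∂P, (∃ᶠ t in atTop, a t ω = InnovationCycles.Action.innovate) →
      limsup (fun T : ℕ => InnovationCycles.innovationShare (fun t => a t ω) T) atTop
          ≤ E.alphaStar ∧
        (E.alphaStar < 1 → ∃ᶠ t in atTop, a t ω = InnovationCycles.Action.safe) := by
  obtain ⟨q, hq⟩ := huniq
  filter_upwards [InnovationCycles.ae_tendsto_successRate hdata, heq.2] with ω hrate hopt hfreq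
  have hbound : ∀ c, E.alphaStar < c → ∃ C : ℝ, ∀ᶠ T : ℕ in atTop,
      (InnovationCycles.trials (InnovationCycles.pathHistory (a · ω) (y · ω) T) : ℝ) ≤
        c * T + C := fun c hc => by
    refine InnovationCycles.exists_trials_le (a · ω) (y · ω)
      ((InnovationCycles.Env.alphaStar_nonneg hmis).trans hc.le) ?_
    filter_upwards [InnovationCycles.Env.eventually_trials_le hx heq.1
      (InnovationCycles.length_pathHistory (a · ω) (y · ω))
      (InnovationCycles.tendsto_trials_atTop (a · ω) (y · ω) hfreq) (hrate hfreq) hmis hq hc]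
      with t ht hat
    refine ht ?_
    have := hopt t .safe
    rwa [hat] at this
  -- The constant `C` depends on `c`, so the bound is proved for each `c > α*` and only then is `c`
  -- lowered to `α*`; the second claim needs just one `c` strictly between `α*` and `1`.
  refine ⟨le_of_forall_gt_imp_ge_of_dense fun c hc => ?_, fun h1 => ?_⟩
  · obtain ⟨C, hC⟩ := hbound c hc
    exact InnovationCycles.limsup_innovationShare_le (a · ω) (y · ω) hC
  · obtain ⟨c, hc, hc1⟩ := exists_between h1
    obtain ⟨C, hC⟩ := hbound c hc
    exact InnovationCycles.frequently_safe (a · ω) (y · ω) hc1 hC
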